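/- Let $\mathcal H$ be the twisted Heisenberg--Virasoro algebra, the complex Lie algebra with basis $L(n), I(n)$ $(n\in\mathbb Z)$, $C_L, C_{LI}, C_I$, where $C_L,C_{LI},C_I$ are central and $$[L(n),L(m)]=(n-m)L(n+m)+\delta_{n,-m}\tfrac{n^3-n}{12}C_L,\quad [L(n),I(m)]=-mI(n+m)-\delta_{n,-m}(n^2+n)C_{LI},\quad [I(n),I(m)]=n\delta_{n,-m}C_I .$$ Let $V^{\mathcal H}(c_L,c_I,c_{L,I},h,h_I)$ be its Verma module: the $U(\mathcal H)$-module induced from the one-dimensional module on which $L(n),I(n)$ $(n\ge 1)$ act by $0$ and $L(0),I(0),C_L,C_I,C_{LI}$ act by $h,h_I,c_L,c_I,c_{L,I}$. Let $\mathfrak h=\mathbb C\alpha\oplus\mathbb C\beta$ with $\langle\alpha,\alpha\rangle=-\langle\beta,\beta\rangle=1$, $\langle\alpha,\beta\rangle=0$, and let $\hat{\mathfrak h}=\mathbb C[t,t^{-1}]\otimes\mathfrak h\oplus\mathbb Cc$ be its affinization, $x(n)=t^n\otimes x$, $[x(n),y(m)]=n\delta_{n,-m}\langle x,y\rangle c$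 with $c$ central. For $\gamma\in\mathfrak h$ let $M(1,\gamma)$ be the $\hat{\mathfrak h}$-module induced from the one-dimensional module $\mathbb C e^\gamma$ on which $x(n)$ $(n\ge1)$ acts by $0$, $x(0)$ by $\langle x,\gamma\rangle$ and $c$ by $1$. Put $\mathcal F_{r,s}=M(1,r\alpha+s\beta)$ for $r,s\in\mathbb C$; $M(1)=M(1,0)$ is the Heisenberg vertex algebra, with vacuum $e^0$ and $Y(x(-1)e^0,z)=\sum_n x(n)z^{-n-1}$, and $\mathcal F_{r,s}$ is an $M(1)$-module. Let $\lambda,\mu\in\mathbb C$ and put $c_L=2-12(\lambda^2-\mu^2)$, $c_{L,I}=\lambda-\mu$; assume $c_{L,I}\neq0$. The components of $I=(\alpha(-1)+\beta(-1))e^0$ and $\omega=(\tfrac12\alpha(-1)^2-\tfrac12\beta(-1)^2+\lambda\alpha(-2)+\mu\beta(-2))e^0$, that is $$I(n)=\alpha(n)+\beta(n),\qquad L(n)=\tfrac12\sum_{k\in\mathbb Z}\bigl({:}\alpha(n-k)\alpha(k){:}-{:}\beta(n-k)\beta(k){:}\bigr)-(n+1)\bigl(\lambda\alpha(n)+\mu\beta(n)\bigr),$$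 define, with $C_L,C_I,C_{LI}$ acting by $c_L,0,c_{L,I}$, the action of $\mathcal H$ on $\mathcal F_{r,s}$. Let $L^{\mathcal H}(c_L,c_{L,I})$ be the vertex subalgebra of $M(1)$ generated by $I$ and $\omega$. Let $r,s\in\mathbb C$, $h=\Delta_{r,s}=\tfrac12r^2-\tfrac12s^2-\lambda r+\mu s$ and $h_I=r-s$, and assume that $\frac{h_I}{c_{L,I}}-1$ is not a negative integer. Then $\mathcal F_{r,s}\cong V^{\mathcal H}(c_L,0,c_{L,I},h,h_I)$, as $\mathcal H$-modules and as $L^{\mathcal H}(c_L,c_{L,I})$-modules: there is a linear isomorphism commuting with the action of $\mathcal H$, and it is an isomorphism of $L^{\mathcal H}(c_L,c_{L,I})$-modules for the unique $L^{\mathcal H}(c_L,c_{L,I})$-module structure on the Verma module with $Y(I,z)=\sum_n I(n)z^{-n-1}$ and $Y(\omega,z)=\sum_n L(n)z^{-n-2}$. -/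

import Mathlib

noncomputable section

namespace HVirFree

/-! ### Lie algebras given by structure constants on a basis -/

/-- The bilinear extension of a bracket prescribed on the basis `X` of the space `X →₀ ℂ`. -/
def bilinExt {X : Type} (br : X → X → (X →₀ ℂ)) :
    (X →₀ ℂ) →ₗ[ℂ] (X →₀ ℂ) →ₗ[ℂ] (X →₀ ℂ) :=
  Finsupp.linearCombination ℂ (fun x => Finsupp.linearCombination ℂ (br x))

theorem bilinExt_single {X : Type} (br : X → X → (X →₀ ℂ)) (x y : X) :
    bilinExt br (Finsupp.single x 1) (Finsupp.single y 1) = br x y := by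
  simp [bilinExt]

theorem bilinExt_skew {X : Type} (br : X → X → (X →₀ ℂ)) (hskew : ∀ x y, br x y = -br y x)
    (u v : X →₀ ℂ) : bilinExt br u v = -bilinExt br v u := by
  induction u using Finsupp.induction_linear with
  | zero => simp
  | add u₁ u₂ h₁ h₂ => rw [map_add, map_add, LinearMap.add_apply, h₁, h₂, neg_add]
  | single x a =>
    induction v using Finsupp.induction_linear with
    | zero => simp
    | add u₁ u₂ h₁ h₂ => rw [map_add, map_add, LinearMap.add_apply, h₁, h₂, neg_add]
    | single y b =>
      have hx : Finsupp.single x a = a • Finsupp.single x (1 : ℂ) := by simp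
      have hy : Finsupp.single y b = b • Finsupp.single y (1 : ℂ) := by simp
      rw [hx, hy]
      rw [map_smul, map_smul, map_smul, map_smul, LinearMap.smul_apply, LinearMap.smul_apply,
        bilinExt_single, bilinExt_single, hskew x y, smul_neg, smul_neg, smul_comm]

theorem bilinExt_self {X : Type} (br : X → X → (X →₀ ℂ)) (hskew : ∀ x y, br x y = -br y x)
    (u : X →₀ ℂ) : bilinExt br u u = 0 :=
  self_eq_neg.mp (bilinExt_skew br hskew u u)

theorem bilinExt_jacobi {X : Type} (br : X → X → (X →₀ ℂ))
    (hjac : ∀ x y z, bilinExt br (Finsupp.single x 1) (br y z) =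
      bilinExt br (br x y) (Finsupp.single z 1) + bilinExt br (Finsupp.single y 1) (br x z))
    (u v w : X →₀ ℂ) :
    bilinExt br u (bilinExt br v w) =
      bilinExt br (bilinExt br u v) w + bilinExt br v (bilinExt br u w) := by
  induction u using Finsupp.induction_linear with
  | zero => simp
  | add u₁ u₂ h₁ h₂ => simp only [map_add, LinearMap.add_apply, h₁, h₂]; abel
  | single x a =>
    induction v using Finsupp.induction_linear with
    | zero => simp
    | add u₁ u₂ h₁ h₂ => simp only [map_add, LinearMap.add_apply, h₁, h₂]; abel
    | single y b =>
      induction w using Finsupp.induction_linear with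
      | zero => simp
      | add u₁ u₂ h₁ h₂ => simp only [map_add, h₁, h₂]; abel
      | single z c =>
        have hx : Finsupp.single x a = a • Finsupp.single x (1 : ℂ) := by simp
        have hy : Finsupp.single y b = b • Finsupp.single y (1 : ℂ) := by simp
        have hz : Finsupp.single z c = c • Finsupp.single z (1 : ℂ) := by simp
        rw [hx, hy, hz]
        simp only [map_smul, LinearMap.smul_apply, bilinExt_single]
        rw [hjac x y z]
        simp only [smul_add, smul_smul]
        congr 2
        all_goals ring

/-! ### The twisted Heisenberg-Virasoro algebra -/

/-- The basis `L(n), I(n) (n ∈ ℤ), C_L, C_{LI}, C_I`. -/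
inductive HVirGen : Type
  | L (n : ℤ)
  | I (n : ℤ)
  | CL
  | CLI
  | CI

/-- The commutation relations on basis elements. -/
def hvirBr : HVirGen → HVirGen → (HVirGen →₀ ℂ)
  | .L n, .L m =>
      ((n : ℂ) - m) • Finsupp.single (.L (n + m)) 1
        + (if n = -m then ((n : ℂ) ^ 3 - n) / 12 else 0) • Finsupp.single .CL 1
  | .L n, .I m =>
      (-(m : ℂ)) • Finsupp.single (.I (n + m)) 1
        - (if n = -m then (n : ℂ) ^ 2 + n else 0) • Finsupp.single .CLI 1
  | .I m, .L n =>
      (m : ℂ) • Finsupp.single (.I (n + m)) 1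
        + (if n = -m then (n : ℂ) ^ 2 + n else 0) • Finsupp.single .CLI 1
  | .I n, .I m => (if n = -m then (n : ℂ) else 0) • Finsupp.single .CI 1
  | _, _ => 0

theorem hvirBr_skew (x y : HVirGen) : hvirBr x y = -hvirBr y x := by
  cases x <;> cases y <;> simp only [hvirBr, neg_zero] <;> rename_i a b
  · rw [add_comm b a]
    split_ifs with h₁ h₂ h₂
    · subst h₁
      push_cast
      module
    · omega
    · omega
    · module
  · module
  · module
  · split_ifs with h₁ h₂ h₂
    · subst h₁
      push_cast
      module
    · omega
    · omega
    · module

theorem hvirBr_jacobi (x y z : HVirGen) :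
    bilinExt hvirBr (Finsupp.single x 1) (hvirBr y z) =
      bilinExt hvirBr (hvirBr x y) (Finsupp.single z 1)
        + bilinExt hvirBr (Finsupp.single y 1) (hvirBr x z) := by
  cases x <;> cases y <;> cases z <;>
    simp only [hvirBr, map_add, map_sub, map_smul, LinearMap.add_apply, LinearMap.sub_apply,
      LinearMap.smul_apply, bilinExt_single, map_zero, LinearMap.zero_apply, smul_zero, add_zero,
      sub_zero, zero_add]
  all_goals
    rename_i a b c
    by_cases h : a + b + c = 0
    · obtain rfl : c = -a - b := by omega
      have e₁ : a + b + (-a - b) = 0 := by ring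
      have e₂ : a + (b + (-a - b)) = 0 := by ring
      have e₃ : b + (a + (-a - b)) = 0 := by ring
      have e₄ : b + (-a - b + a) = 0 := by ring
      have e₅ : a + (-a - b + b) = 0 := by ring
      have e₆ : -a - b + (a + b) = 0 := by ring
      have e₇ : a + (-a - b) + b = 0 := by ring
      have e₈ : b + (-a - b) + a = 0 := by ring
      have e₉ : -a - b + (b + a) = 0 := by ring
      try simp only [e₁, e₂, e₃, e₄, e₅, e₆, e₇, e₈, e₉]
      split_ifs <;> first | (exfalso; omega) | (push_cast; module)
    · try simp only [add_comm, add_left_comm]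
      split_ifs <;> first | (exfalso; omega) | (push_cast; module)

/-- The twisted Heisenberg-Virasoro algebra. -/
def HVir : Type := HVirGen →₀ ℂ

instance : AddCommGroup HVir := inferInstanceAs (AddCommGroup (HVirGen →₀ ℂ))

instance : Module ℂ HVir := inferInstanceAs (Module ℂ (HVirGen →₀ ℂ))

instance : LieRing HVir where
  bracket u v := bilinExt hvirBr u v
  add_lie u v w := LinearMap.map_add₂ (bilinExt hvirBr) u v w
  lie_add u v w := map_add (bilinExt hvirBr u) v w
  lie_self u := bilinExt_self hvirBr hvirBr_skew u
  leibniz_lie u v w := bilinExt_jacobi hvirBr hvirBr_jacobi u v w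

instance : LieAlgebra ℂ HVir where
  lie_smul t u v := map_smul (bilinExt hvirBr u) t v

/-- A basis element as an element of the algebra. -/
def HVir.of (x : HVirGen) : HVir := Finsupp.single x (1 : ℂ)

/-! ### The affinization of the rank two hyperbolic abelian Lie algebra -/

/-- `𝔥 = ℂα ⊕ ℂβ`; the pair `![x, y]` stands for `xα + yβ`. -/
abbrev Hyp : Type := Fin 2 → ℂ

/-- The symmetric form with `⟨α, α⟩ = 1`, `⟨β, β⟩ = -1`, `⟨α, β⟩ = 0`. -/
def form (x y : Hyp) : ℂ := x 0 * y 0 - x 1 * y 1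

/-- The vectors `α` (for `0`) and `β` (for `1`). -/
def hypBasis (i : Fin 2) : Hyp := Pi.single i 1

/-- The basis `α(n), β(n) (n ∈ ℤ), c` of `ĥ = ℂ[t, t⁻¹] ⊗ 𝔥 ⊕ ℂc`. -/
inductive HeisGen : Type
  | mode (i : Fin 2) (n : ℤ)
  | c

/-- `[x(n), y(m)] = n δ_{n,-m} ⟨x, y⟩ c` on basis elements. -/
def heisBr : HeisGen → HeisGen → (HeisGen →₀ ℂ)
  | .mode i n, .mode j m =>
      (if n = -m then (n : ℂ) * form (hypBasis i) (hypBasis j) else 0) • Finsupp.single .c 1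
  | _, _ => 0

theorem heisBr_skew (x y : HeisGen) : heisBr x y = -heisBr y x := by
  cases x <;> cases y <;> simp only [heisBr, neg_zero]
  rename_i i a j b
  have hf : form (hypBasis j) (hypBasis i) = form (hypBasis i) (hypBasis j) := by
    simp only [form]
    ring
  rw [hf]
  split_ifs with h₁ h₂ h₂
  · subst h₁
    push_cast
    module
  · omega
  · omega
  · module

theorem heisBr_jacobi (x y z : HeisGen) :
    bilinExt heisBr (Finsupp.single x 1) (heisBr y z) =
      bilinExt heisBr (heisBr x y) (Finsupp.single z 1)
        + bilinExt heisBr (Finsupp.single y 1) (heisBr x z) := by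
  cases x <;> cases y <;> cases z <;>
    simp only [heisBr, map_smul, LinearMap.smul_apply, bilinExt_single, map_zero,
      LinearMap.zero_apply, smul_zero, add_zero]

/-- The Lie algebra `ĥ`. -/
def HeisHat : Type := HeisGen →₀ ℂ

instance : AddCommGroup HeisHat := inferInstanceAs (AddCommGroup (HeisGen →₀ ℂ))

instance : Module ℂ HeisHat := inferInstanceAs (Module ℂ (HeisGen →₀ ℂ))

instance : LieRing HeisHat where
  bracket u v := bilinExt heisBr u v
  add_lie u v w := LinearMap.map_add₂ (bilinExt heisBr) u v w
  lie_add u v w := map_add (bilinExt heisBr u) v w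
  lie_self u := bilinExt_self heisBr heisBr_skew u
  leibniz_lie u v w := bilinExt_jacobi heisBr heisBr_jacobi u v w

instance : LieAlgebra ℂ HeisHat where
  lie_smul t u v := map_smul (bilinExt heisBr u) t v

/-- The central element `c`. -/
def HeisHat.c : HeisHat := Finsupp.single HeisGen.c (1 : ℂ)

/-- The element `x(n) = tⁿ ⊗ x` for `x ∈ 𝔥`. -/
def HeisHat.mode (x : Hyp) (n : ℤ) : HeisHat :=
  (Finsupp.single (HeisGen.mode 0 n) (x 0) + Finsupp.single (HeisGen.mode 1 n) (x 1) :
    HeisGen →₀ ℂ)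

/-! ### Modules induced from one-dimensional modules -/

section Induced

variable {𝔤 : Type} [LieRing 𝔤] [LieAlgebra ℂ 𝔤]

/-- The left ideal of `U(𝔤)` generated by the elements `x - t` with `(x, t) ∈ R`. -/
def relIdeal (R : Set (𝔤 × ℂ)) :
    Submodule (UniversalEnvelopingAlgebra ℂ 𝔤) (UniversalEnvelopingAlgebra ℂ 𝔤) :=
  Submodule.span _ {u | ∃ p ∈ R, u = UniversalEnvelopingAlgebra.ι ℂ p.1 - algebraMap ℂ _ p.2}

/-- The cyclic module `U(𝔤) / U(𝔤)⟨x - t : (x, t) ∈ R⟩`. If `R` is the graph of a character `χ` of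
a subalgebra `𝔟` (or is a set of generators of that graph), this is the induced module
`U(𝔤) ⊗_{U(𝔟)} ℂ_χ`. -/
def Ind (R : Set (𝔤 × ℂ)) : Type := UniversalEnvelopingAlgebra ℂ 𝔤 ⧸ relIdeal R

variable (R : Set (𝔤 × ℂ))

instance : AddCommGroup (Ind R) :=
  inferInstanceAs (AddCommGroup (UniversalEnvelopingAlgebra ℂ 𝔤 ⧸ relIdeal R))

instance : Module (UniversalEnvelopingAlgebra ℂ 𝔤) (Ind R) :=
  inferInstanceAs (Module (UniversalEnvelopingAlgebra ℂ 𝔤)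
    (UniversalEnvelopingAlgebra ℂ 𝔤 ⧸ relIdeal R))

instance : Module ℂ (Ind R) :=
  inferInstanceAs (Module ℂ (UniversalEnvelopingAlgebra ℂ 𝔤 ⧸ relIdeal R))

instance : IsScalarTower ℂ (UniversalEnvelopingAlgebra ℂ 𝔤) (Ind R) :=
  inferInstanceAs (IsScalarTower ℂ (UniversalEnvelopingAlgebra ℂ 𝔤)
    (UniversalEnvelopingAlgebra ℂ 𝔤 ⧸ relIdeal R))

/-- The action of `x ∈ 𝔤` is the action of its image in `U(𝔤)`. -/
instance : LieRingModule 𝔤 (Ind R) where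
  bracket x m := UniversalEnvelopingAlgebra.ι ℂ x • m
  add_lie x y m := by
    change UniversalEnvelopingAlgebra.ι ℂ (x + y) • m = _
    rw [map_add, add_smul]
  lie_add x m n := smul_add _ _ _
  leibniz_lie x y m := by
    change UniversalEnvelopingAlgebra.ι ℂ x • UniversalEnvelopingAlgebra.ι ℂ y • m =
      UniversalEnvelopingAlgebra.ι ℂ ⁅x, y⁆ • m +
        UniversalEnvelopingAlgebra.ι ℂ y • UniversalEnvelopingAlgebra.ι ℂ x • m
    let _ : LieRing (UniversalEnvelopingAlgebra ℂ 𝔤) := LieRing.ofAssociativeRing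
    rw [LieHom.map_lie, LieRing.of_associative_ring_bracket, sub_smul, smul_smul, smul_smul]
    exact (sub_add_cancel (_ : Ind R) _).symm

instance : LieModule ℂ 𝔤 (Ind R) where
  smul_lie t x m := by
    change UniversalEnvelopingAlgebra.ι ℂ (t • x) • m = t • UniversalEnvelopingAlgebra.ι ℂ x • m
    rw [map_smul, smul_assoc]
  lie_smul t x m := by
    change UniversalEnvelopingAlgebra.ι ℂ x • t • m = t • UniversalEnvelopingAlgebra.ι ℂ x • m
    rw [← algebraMap_smul (UniversalEnvelopingAlgebra ℂ 𝔤) t m, smul_smul,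
      ← Algebra.commutes, ← smul_smul, algebraMap_smul]

/-- The generator, that is the class of `1`. -/
def Ind.gen : Ind R := (relIdeal R).mkQ 1

/-- A subspace of `Ind R` that contains the generator and is stable under `𝔤` is everything. -/
theorem Ind.submodule_eq_top (S : Submodule ℂ (Ind R)) (hgen : Ind.gen R ∈ S)
    (hS : ∀ (x : 𝔤), ∀ w ∈ S, ⁅x, w⁆ ∈ S) : S = ⊤ := by
  let B : Subalgebra ℂ (UniversalEnvelopingAlgebra ℂ 𝔤) :=
    Algebra.adjoin ℂ (Set.range (UniversalEnvelopingAlgebra.ι ℂ : 𝔤 → _))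
  let _ : LieRing (UniversalEnvelopingAlgebra ℂ 𝔤) := LieRing.ofAssociativeRing
  let _ : LieRing B := LieRing.ofAssociativeRing
  let f : 𝔤 →ₗ⁅ℂ⁆ B :=
    { toFun := fun x => ⟨UniversalEnvelopingAlgebra.ι ℂ x, Algebra.subset_adjoin ⟨x, rfl⟩⟩
      map_add' := fun x y => Subtype.ext (map_add _ x y)
      map_smul' := fun t x => Subtype.ext (map_smul _ t x)
      map_lie' := fun {x y} => Subtype.ext (LieHom.map_lie _ x y) }
  have hid : B.val.comp (UniversalEnvelopingAlgebra.lift ℂ f) =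
      AlgHom.id ℂ (UniversalEnvelopingAlgebra ℂ 𝔤) := by
    ext x
    simp [f]
  have hB : ∀ u : UniversalEnvelopingAlgebra ℂ 𝔤, u ∈ B := by
    intro u
    have h := AlgHom.congr_fun hid u
    rw [AlgHom.id_apply] at h
    rw [← h]
    exact (UniversalEnvelopingAlgebra.lift ℂ f u).2
  have key : ∀ u ∈ B, ∀ w ∈ S, u • w ∈ S := by
    intro u hu
    induction hu using Algebra.adjoin_induction with
    | mem x hx =>
      obtain ⟨y, rfl⟩ := hx
      exact fun w hw => hS y w hw
    | algebraMap t =>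
      intro w hw
      rw [algebraMap_smul]
      exact S.smul_mem t hw
    | add x y _ _ hx hy =>
      intro w hw
      rw [add_smul]
      exact S.add_mem (hx w hw) (hy w hw)
    | mul x y _ _ hx hy =>
      intro w hw
      rw [mul_smul]
      exact hx _ (hy w hw)
  rw [eq_top_iff]
  intro w _
  obtain ⟨u, rfl⟩ := (relIdeal R).mkQ_surjective w
  have h := key u (hB u) _ hgen
  have e : u • Ind.gen R = (relIdeal R).mkQ u := by
    change u • (relIdeal R).mkQ 1 = _
    rw [← map_smul, smul_eq_mul, mul_one]
  rw [e] at h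
  exact h

end Induced

/-! ### Verma modules over the twisted Heisenberg-Virasoro algebra -/

/-- The action of the nonnegative part of the algebra on the highest weight line: `L(n)` and `I(n)`
act by `0` for `n ≥ 1`, and `L(0), I(0), C_L, C_I, C_{LI}` by `h, h_I, c_L, c_I, c_{L,I}`. -/
def vermaRel (cL cI cLI h hI : ℂ) : Set (HVir × ℂ) :=
  {p | (∃ n : ℤ, 1 ≤ n ∧ (p = (HVir.of (.L n), 0) ∨ p = (HVir.of (.I n), 0)))
    ∨ p = (HVir.of (.L 0), h) ∨ p = (HVir.of (.I 0), hI)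
    ∨ p = (HVir.of .CL, cL) ∨ p = (HVir.of .CI, cI) ∨ p = (HVir.of .CLI, cLI)}

/-- The Verma module `V^{HVir}(c_L, c_I, c_{L,I}, h, h_I)`. -/
abbrev Verma (cL cI cLI h hI : ℂ) : Type := Ind (vermaRel cL cI cLI h hI)

/-! ### Fock modules -/

/-- The action of `ℂ[t] ⊗ 𝔥 ⊕ ℂc` on the highest weight line of `M(1, γ)`: `x(n)` acts by `0` for
`n ≥ 1`, `x(0)` by `⟨x, γ⟩`, and `c` by `1`. -/
def fockRel (γ : Hyp) : Set (HeisHat × ℂ) :=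
  {p | (∃ (x : Hyp) (n : ℤ), 1 ≤ n ∧ p = (HeisHat.mode x n, 0))
    ∨ (∃ x : Hyp, p = (HeisHat.mode x 0, form x γ)) ∨ p = (HeisHat.c, 1)}

/-- The `ĥ`-module `M(1, γ)`. -/
abbrev M1 (γ : Hyp) : Type := Ind (fockRel γ)

/-- The highest weight vector `e^γ`. -/
def expVec (γ : Hyp) : M1 γ := Ind.gen (fockRel γ)

/-- The operator `x(n)` on `M(1, γ)`. -/
def modeOp (γ : Hyp) (x : Hyp) (n : ℤ) : Module.End ℂ (M1 γ) :=
  LieModule.toEnd ℂ HeisHat (M1 γ) (HeisHat.mode x n)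

/-- The normally ordered product `:x(j) x(k):`. -/
def normOrd (γ : Hyp) (x : Hyp) (j k : ℤ) : Module.End ℂ (M1 γ) :=
  if j ≤ k then modeOp γ x j * modeOp γ x k else modeOp γ x k * modeOp γ x j

theorem mode_bracket_eventually_zero (x : Hyp) (y : HeisHat) :
    ∃ N : ℤ, ∀ n, N ≤ n → ⁅HeisHat.mode x n, y⁆ = 0 := by
  change ∃ N : ℤ, ∀ n, N ≤ n → bilinExt heisBr (Finsupp.single (HeisGen.mode 0 n) (x 0)
    + Finsupp.single (HeisGen.mode 1 n) (x 1)) y = 0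
  induction y using Finsupp.induction_linear with
  | zero => exact ⟨0, fun n _ => map_zero _⟩
  | add u v hu hv =>
    obtain ⟨N₁, h₁⟩ := hu
    obtain ⟨N₂, h₂⟩ := hv
    refine ⟨max N₁ N₂, fun n hn => ?_⟩
    rw [map_add, h₁ n (le_trans (le_max_left _ _) hn), h₂ n (le_trans (le_max_right _ _) hn),
      add_zero]
  | single g t =>
    cases g with
    | c => exact ⟨0, fun n _ => by simp [bilinExt, heisBr]⟩
    | mode j m =>
      refine ⟨1 - m, fun n hn => ?_⟩
      have h : n ≠ -m := by omega
      simp [bilinExt, heisBr, h]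

theorem modeOp_expVec (γ : Hyp) (x : Hyp) (n : ℤ) (hn : 1 ≤ n) :
    modeOp γ x n (expVec γ) = 0 := by
  have h : UniversalEnvelopingAlgebra.ι ℂ (HeisHat.mode x n) ∈ relIdeal (fockRel γ) :=
    Submodule.subset_span ⟨(HeisHat.mode x n, 0), Or.inl ⟨x, n, hn, rfl⟩, by simp⟩
  change UniversalEnvelopingAlgebra.ι ℂ (HeisHat.mode x n) • (relIdeal (fockRel γ)).mkQ 1 = 0
  rw [← map_smul, smul_eq_mul, mul_one]
  exact (Submodule.Quotient.mk_eq_zero _).mpr h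

theorem modeOp_eventually_zero (γ : Hyp) (x : Hyp) (w : M1 γ) :
    ∃ N : ℤ, ∀ n, N ≤ n → modeOp γ x n w = 0 := by
  let S : Submodule ℂ (M1 γ) :=
    { carrier := {w | ∃ N : ℤ, ∀ n, N ≤ n → modeOp γ x n w = 0}
      zero_mem' := ⟨0, fun n _ => map_zero _⟩
      add_mem' := by
        rintro u v ⟨N₁, h₁⟩ ⟨N₂, h₂⟩
        refine ⟨max N₁ N₂, fun n hn => ?_⟩
        rw [map_add, h₁ n (le_trans (le_max_left _ _) hn),
          h₂ n (le_trans (le_max_right _ _) hn), add_zero]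
      smul_mem' := by
        rintro t u ⟨N, h⟩
        exact ⟨N, fun n hn => by rw [map_smul, h n hn, smul_zero]⟩ }
  have hS : S = ⊤ := by
    apply Ind.submodule_eq_top
    · exact ⟨1, fun n hn => modeOp_expVec γ x n hn⟩
    · rintro y v ⟨N₁, h₁⟩
      obtain ⟨N₂, h₂⟩ := mode_bracket_eventually_zero x y
      refine ⟨max N₁ N₂, fun n hn => ?_⟩
      have h₃ := h₁ n (le_trans (le_max_left _ _) hn)
      have h₄ := h₂ n (le_trans (le_max_right _ _) hn)
      simp only [modeOp, LieModule.toEnd_apply_apply] at h₃ ⊢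
      rw [leibniz_lie, h₃, h₄, zero_lie, lie_zero, add_zero]
  have hw : w ∈ S := hS ▸ Submodule.mem_top
  exact hw

theorem normOrd_finite (γ : Hyp) (x : Hyp) (n : ℤ) (w : M1 γ) :
    (Function.support fun k : ℤ => normOrd γ x (n - k) k w).Finite := by
  obtain ⟨N, hN⟩ := modeOp_eventually_zero γ x w
  refine (Set.finite_Ioo (n - N) N).subset fun k hk => ?_
  by_contra hk'
  apply hk
  have h : N ≤ k ∨ N ≤ n - k := by
    simp only [Set.mem_Ioo, not_and_or] at hk'
    omega
  simp only [normOrd]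
  split_ifs with h'
  · rw [Module.End.mul_apply, hN k (by omega), map_zero]
  · rw [Module.End.mul_apply, hN (n - k) (by omega), map_zero]

/-- The operator `∑_{k ∈ ℤ} :x(n - k) x(k):`, a finite sum on each vector. -/
def quadOp (γ : Hyp) (x : Hyp) (n : ℤ) : Module.End ℂ (M1 γ) where
  toFun w := ∑ᶠ k : ℤ, normOrd γ x (n - k) k w
  map_add' v w := by
    simp only [map_add]
    exact finsum_add_distrib (normOrd_finite γ x n v) (normOrd_finite γ x n w)
  map_smul' t w := by
    simp only [map_smul, RingHom.id_apply]
    exact (smul_finsum t _).symm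

/-- The vector `α` of `𝔥`. -/
def alpha : Hyp := hypBasis 0

/-- The vector `β` of `𝔥`. -/
def beta : Hyp := hypBasis 1

/-- `I(n) = α(n) + β(n)`, the component of the field of `I = α(-1) + β(-1)`. -/
def fockI (γ : Hyp) (n : ℤ) : Module.End ℂ (M1 γ) := modeOp γ (alpha + beta) n

/-- `L(n) = ½ ∑_k (:α(n-k)α(k): - :β(n-k)β(k):) - (n+1)(λ α(n) + μ β(n))`, the component of the
field of `ω = ½ α(-1)² - ½ β(-1)² + λ α(-2) + μ β(-2)`. -/
def fockL (lam mu : ℂ) (γ : Hyp) (n : ℤ) : Module.End ℂ (M1 γ) :=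
  (1 / 2 : ℂ) • quadOp γ alpha n - (1 / 2 : ℂ) • quadOp γ beta n
    - ((n : ℂ) + 1) • (lam • modeOp γ alpha n + mu • modeOp γ beta n)

/-- The Fock space `F_{r,s} = M(1, rα + sβ)`. -/
abbrev Fock (r s : ℂ) : Type := M1 (r • alpha + s • beta)

/-- The operators on `M(1, γ)` assigned to the basis elements of the algebra: the components `L(n)`
and `I(n)` of the fields, and the scalars `c_L = 2 - 12(λ² - μ²)`, `c_{L,I} = λ - μ`, `c_I = 0`. -/
def fockGen (lam mu : ℂ) (γ : Hyp) : HVirGen → Module.End ℂ (M1 γ)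
  | .L n => fockL lam mu γ n
  | .I n => fockI γ n
  | .CL => (2 - 12 * (lam ^ 2 - mu ^ 2)) • 1
  | .CLI => (lam - mu) • 1
  | .CI => 0

/-- The action of the twisted Heisenberg-Virasoro algebra on `M(1, γ)`. -/
def fockAction (lam mu : ℂ) (γ : Hyp) : HVir →ₗ[ℂ] Module.End ℂ (M1 γ) :=
  Finsupp.linearCombination ℂ (fockGen lam mu γ)

/-- `Δ_{r,s} = ½ r² - ½ s² - λ r + μ s`. -/
def Delta (lam mu r s : ℂ) : ℂ := r ^ 2 / 2 - s ^ 2 / 2 - lam * r + mu * s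

/-! ### Vertex algebras and their modules -/

section VertexAlgebras

variable {V : Type} [AddCommGroup V] [Module ℂ V]

/-- The Borcherds identity, for the products `Y` of a vertex algebra `V` and the modes `Y'` of its
action on `W`. All sums are finite by the truncation axioms. -/
def BorcherdsIdentity {W : Type} [AddCommGroup W] [Module ℂ W]
    (Y : V →ₗ[ℂ] ℤ → Module.End ℂ V) (Y' : V →ₗ[ℂ] ℤ → Module.End ℂ W) : Prop :=
  ∀ (a b : V) (w : W) (m n k : ℤ),
    (∑ᶠ j : ℕ, Ring.choose m j • Y' (Y a (n + j) b) (m + k - j) w) =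
      ∑ᶠ j : ℕ, ((-1 : ℤ) ^ j * Ring.choose n j) •
        (Y' a (m + n - j) (Y' b (k + j) w)
          - n.negOnePow • Y' b (n + k - j) (Y' a (m + j) w))

/-- A vertex algebra structure on `V`; `Y a n` is the mode `a_n` in
`Y(a, z) = ∑ a_n z^{-n-1}`. -/
structure VertexAlgebra (V : Type) [AddCommGroup V] [Module ℂ V] where
  vac : V
  Y : V →ₗ[ℂ] ℤ → Module.End ℂ V
  truncation : ∀ a b : V, ∃ N : ℤ, ∀ n, N ≤ n → Y a n b = 0
  vac_apply : ∀ (n : ℤ) (b : V), Y vac n b = if n = -1 then b else 0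
  apply_vac : ∀ a : V, Y a (-1) vac = a ∧ ∀ n, 0 ≤ n → Y a n vac = 0
  borcherds : BorcherdsIdentity Y Y

/-- A module structure on `W` over a vertex algebra. -/
structure VertexModule (A : VertexAlgebra V) (W : Type) [AddCommGroup W] [Module ℂ W] where
  Y : V →ₗ[ℂ] ℤ → Module.End ℂ W
  truncation : ∀ (a : V) (w : W), ∃ N : ℤ, ∀ n, N ≤ n → Y a n w = 0
  vac_apply : ∀ (n : ℤ) (w : W), Y A.vac n w = if n = -1 then w else 0
  borcherds : BorcherdsIdentity A.Y Y

/-- A subspace is a vertex subalgebra if it contains the vacuum and is closed under all products. -/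
def VertexAlgebra.IsSub (A : VertexAlgebra V) (S : Submodule ℂ V) : Prop :=
  A.vac ∈ S ∧ ∀ a ∈ S, ∀ b ∈ S, ∀ n : ℤ, A.Y a n b ∈ S

/-- A vertex subalgebra as a vertex algebra. -/
def VertexAlgebra.restrict (A : VertexAlgebra V) (S : Submodule ℂ V) (hS : A.IsSub S) :
    VertexAlgebra S where
  vac := ⟨A.vac, hS.1⟩
  Y :=
    { toFun := fun a n => (A.Y a n).restrict (fun b hb => hS.2 a a.2 b hb n)
      map_add' := fun a b => by
        ext n c
        simp
      map_smul' := fun t a => by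
        ext n c
        simp }
  truncation := fun a b => by
    obtain ⟨N, hN⟩ := A.truncation a b
    exact ⟨N, fun n hn => Subtype.ext (hN n hn)⟩
  vac_apply := fun n b => by
    apply Subtype.ext
    refine (A.vac_apply n b).trans ?_
    split_ifs <;> rfl
  apply_vac := fun a =>
    ⟨Subtype.ext (A.apply_vac a).1, fun n hn => Subtype.ext ((A.apply_vac a).2 n hn)⟩
  borcherds := fun a b w m n k => by
    apply S.subtype_injective
    have h := A.borcherds a b w m n k
    have e := fun f : ℕ → S =>
      S.subtype.toAddMonoidHom.map_finsum_of_injective S.subtype_injective f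
    simp only [LinearMap.toAddMonoidHom_coe] at e
    rw [e, e]
    exact h

/-- The restriction of a module to a vertex subalgebra. -/
def VertexModule.restrict {A : VertexAlgebra V} {W : Type} [AddCommGroup W] [Module ℂ W]
    (M : VertexModule A W) (S : Submodule ℂ V) (hS : A.IsSub S) :
    VertexModule (A.restrict S hS) W where
  Y := M.Y ∘ₗ S.subtype
  truncation := fun a w => M.truncation a w
  vac_apply := fun n w => M.vac_apply n w
  borcherds := fun a b w m n k => M.borcherds a b w m n k

/-- The vertex subalgebra generated by a set. -/
def VertexAlgebra.gen (A : VertexAlgebra V) (X : Set V) : Submodule ℂ V :=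
  sInf {S | A.IsSub S ∧ X ⊆ S}

theorem VertexAlgebra.isSub_gen (A : VertexAlgebra V) (X : Set V) : A.IsSub (A.gen X) := by
  refine ⟨Submodule.mem_sInf.mpr fun S hS => hS.1.1, fun a ha b hb n => ?_⟩
  refine Submodule.mem_sInf.mpr fun S hS => ?_
  exact hS.1.2 a (Submodule.mem_sInf.mp ha S hS) b (Submodule.mem_sInf.mp hb S hS) n

theorem VertexAlgebra.subset_gen (A : VertexAlgebra V) (X : Set V) : X ⊆ A.gen X :=
  fun _ hx => Submodule.mem_sInf.mpr fun _ hS => hS.2 hx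

end VertexAlgebras

/-! ### The Heisenberg vertex algebra and the Heisenberg-Virasoro vertex algebra -/

/-- `A` is the Heisenberg vertex algebra structure on `M(1) = M(1, 0)`: the vacuum is `e⁰`, and
`Y(x(-1)e⁰, z) = ∑ x(n) z^{-n-1}` for `x ∈ 𝔥`. As `M(1)` is generated by the vectors `x(-1)e⁰`,
this determines the structure. -/
def IsHeisenberg (A : VertexAlgebra (M1 0)) : Prop :=
  A.vac = expVec 0 ∧ ∀ (x : Hyp) (n : ℤ), A.Y (modeOp 0 x (-1) (expVec 0)) n = modeOp 0 x n

/-- `M` is the standard `M(1)`-module structure on `M(1, γ)`: `Y(x(-1)e⁰, z)` acts as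
`∑ x(n) z^{-n-1}`. -/
def IsHeisenbergModule {A : VertexAlgebra (M1 0)} {γ : Hyp} (M : VertexModule A (M1 γ)) : Prop :=
  ∀ (x : Hyp) (n : ℤ), M.Y (modeOp 0 x (-1) (expVec 0)) n = modeOp γ x n

/-- The Heisenberg vector `I = α(-1) + β(-1)`. -/
def vecI : M1 0 := modeOp 0 alpha (-1) (expVec 0) + modeOp 0 beta (-1) (expVec 0)

/-- The Virasoro vector `ω = ½ α(-1)² - ½ β(-1)² + λ α(-2) + μ β(-2)`. -/
def vecOmega (lam mu : ℂ) : M1 0 :=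
  (1 / 2 : ℂ) • modeOp 0 alpha (-1) (modeOp 0 alpha (-1) (expVec 0))
    - (1 / 2 : ℂ) • modeOp 0 beta (-1) (modeOp 0 beta (-1) (expVec 0))
    + lam • modeOp 0 alpha (-2) (expVec 0) + mu • modeOp 0 beta (-2) (expVec 0)

/-- The underlying space of the Heisenberg-Virasoro vertex algebra `L^{HVir}(c_L, c_{L,I})`, the
vertex subalgebra of `M(1)` generated by `I` and `ω`. -/
def hvirSub (A : VertexAlgebra (M1 0)) (lam mu : ℂ) : Submodule ℂ (M1 0) :=
  A.gen {vecI, vecOmega lam mu}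

/-- The Heisenberg-Virasoro vertex algebra. -/
abbrev hvirVA (A : VertexAlgebra (M1 0)) (lam mu : ℂ) : VertexAlgebra (hvirSub A lam mu) :=
  A.restrict (hvirSub A lam mu) (A.isSub_gen _)

/-- `I` as an element of the Heisenberg-Virasoro vertex algebra. -/
def subI (A : VertexAlgebra (M1 0)) (lam mu : ℂ) : hvirSub A lam mu :=
  ⟨vecI, A.subset_gen _ (Or.inl rfl)⟩

/-- `ω` as an element of the Heisenberg-Virasoro vertex algebra. -/
def subOmega (A : VertexAlgebra (M1 0)) (lam mu : ℂ) : hvirSub A lam mu :=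
  ⟨vecOmega lam mu, A.subset_gen _ (Or.inr rfl)⟩

/-- The module structure `N` over the Heisenberg-Virasoro vertex algebra extends the action of the
Lie algebra on `W`: `Y(I, z) = ∑ I(n) z^{-n-1}` and `Y(ω, z) = ∑ L(n) z^{-n-2}`. -/
def ExtendsLie {A : VertexAlgebra (M1 0)} {lam mu : ℂ} {W : Type} [AddCommGroup W] [Module ℂ W]
    [LieRingModule HVir W] (N : VertexModule (hvirVA A lam mu) W) : Prop :=
  ∀ (n : ℤ) (w : W), N.Y (subI A lam mu) n w = ⁅HVir.of (.I n), w⁆ ∧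
    N.Y (subOmega A lam mu) (n + 1) w = ⁅HVir.of (.L n), w⁆

/-- A linear isomorphism of modules over a vertex algebra. -/
def IsModuleIso {V : Type} [AddCommGroup V] [Module ℂ V] {A : VertexAlgebra V} {W W' : Type}
    [AddCommGroup W] [Module ℂ W] [AddCommGroup W'] [Module ℂ W'] (M : VertexModule A W)
    (N : VertexModule A W') (φ : W ≃ₗ[ℂ] W') : Prop :=
  ∀ (a : V) (n : ℤ) (w : W), φ (M.Y a n w) = N.Y a n (φ w)

end HVirFree

end

noncomputable section

namespace HVirFree


/-! ### Representations from structure constants, and maps out of induced modules -/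

/-! The universal property of the Verma module gives an `HVir`-map `vermaToFock` sending the highest
weight vector to `e^γ`. It is bijective because it is triangular with nonzero diagonal entries.

Put `I = α + β` and `J = α - β`, so that the Fock module is a polynomial ring in the commuting
operators `I(-k-1)`, `J(-k-1)` (`toPoly_bijective`). In these variables the quadratic part of `L` is
a sum of products `I·J`. The term with `I(0) = h_I` and the linear background term together make
`J(-k-1)` occur in `L(-k-1)` with coefficient `(h_I + k c_{L,I})/2` (`leadCoeff`). The assumption on
`h_I / c_{L,I} - 1` says exactly that none of these coefficients vanishes.

Give `I(-n)` degree `0`, and `J(-n)` and `L(-n)` degree `n + 1`. The shift by one makes every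
commutator of negative modes strictly lower, since `[L(-m), J(-n)]` is a multiple of `J(-m-n)`, of
degree `m + n + 1 < (m + 1) + (n + 1)`. Hence a word in the `I(-n)` and `L(-n)` maps to a nonzero
multiple of the same word in the `I(-n)` and `J(-n)`, plus terms of lower degree
(`vermaToFock_word`). On the Verma side only the spanning half of Poincaré–Birkhoff–Witt is needed
(`span_vermaWord`, `vermaWord_perm`): a surjection from polynomials onto the Verma module, followed
by `vermaToFock`, is unipotent, so both maps are bijective.

That the free field operators represent `HVir` is proved in `fockL_comm`: the defect of the Virasoro
relation commutes with all Heisenberg modes, so it is a scalar, read off from a vacuum coefficient.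

For the vertex algebra statement, the Borcherds identity computes the modes of `I` and `ω` on the
Fock module (`Y_vecI`, `Y_vecOmega`). The module structure is transported along the isomorphism, and
`VertexModule.eq_of_gen` gives uniqueness, because modes of generators determine modes of all
products. -/

theorem linearCombination_bilinExt {X W : Type} [AddCommGroup W] [Module ℂ W]
    (br : X → X → (X →₀ ℂ)) (ρ : X → Module.End ℂ W)
    (h : ∀ x y, Finsupp.linearCombination ℂ ρ (br x y) = ρ x * ρ y - ρ y * ρ x)
    (u v : X →₀ ℂ) :
    Finsupp.linearCombination ℂ ρ (bilinExt br u v) =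
      Finsupp.linearCombination ℂ ρ u * Finsupp.linearCombination ℂ ρ v
        - Finsupp.linearCombination ℂ ρ v * Finsupp.linearCombination ℂ ρ u := by
  induction u using Finsupp.induction_linear with
  | zero => simp
  | add u₁ u₂ h₁ h₂ =>
    simp only [map_add, LinearMap.add_apply, h₁, h₂, add_mul, mul_add]
    abel
  | single x a =>
    induction v using Finsupp.induction_linear with
    | zero => simp
    | add u₁ u₂ h₁ h₂ =>
      simp only [map_add, h₁, h₂, add_mul, mul_add]
      abel
    | single y b =>
      have hx : Finsupp.single x a = a • Finsupp.single x (1 : ℂ) := by simp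
      have hy : Finsupp.single y b = b • Finsupp.single y (1 : ℂ) := by simp
      rw [hx, hy]
      simp only [map_smul, LinearMap.smul_apply, bilinExt_single, h,
        Finsupp.linearCombination_single, one_smul, smul_mul_assoc, mul_smul_comm, smul_sub]
      rw [smul_comm b a (ρ y * ρ x)]

section Induced

variable {𝔤 : Type} [LieRing 𝔤] [LieAlgebra ℂ 𝔤] (R : Set (𝔤 × ℂ))

theorem Ind.lie_gen {p : 𝔤 × ℂ} (hp : p ∈ R) : ⁅p.1, Ind.gen R⁆ = p.2 • Ind.gen R := by
  have h : UniversalEnvelopingAlgebra.ι ℂ p.1 - algebraMap ℂ _ p.2 ∈ relIdeal R :=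
    Submodule.subset_span ⟨p, hp, rfl⟩
  have h' : (UniversalEnvelopingAlgebra.ι ℂ p.1 - algebraMap ℂ _ p.2) • Ind.gen R = 0 := by
    refine ((relIdeal R).mkQ.map_smul _ 1).symm.trans ?_
    rw [smul_eq_mul, mul_one]
    exact (Submodule.Quotient.mk_eq_zero _).mpr h
  rw [sub_smul, algebraMap_smul, sub_eq_zero] at h'
  exact h'

/-- Linear maps out of a cyclic module that agree on the generator and intertwine are equal. -/
theorem Ind.hom_ext {W : Type} [AddCommGroup W] [Module ℂ W] (ρ : 𝔤 → Module.End ℂ W)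
    (f g : Ind R →ₗ[ℂ] W) (hgen : f (Ind.gen R) = g (Ind.gen R))
    (hf : ∀ x w, f ⁅x, w⁆ = ρ x (f w)) (hg : ∀ x w, g ⁅x, w⁆ = ρ x (g w)) : f = g := by
  have h : LinearMap.eqLocus f g = ⊤ := by
    apply Ind.submodule_eq_top
    · exact hgen
    · intro x w hw
      change f _ = g _
      rw [hf, hg]
      exact congrArg _ hw
  ext w
  exact (h ▸ Submodule.mem_top : w ∈ LinearMap.eqLocus f g)

variable {W : Type} [AddCommGroup W] [Module ℂ W] (ρ : 𝔤 →ₗ[ℂ] Module.End ℂ W)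
  (hρ : ∀ x y, ρ ⁅x, y⁆ = ρ x * ρ y - ρ y * ρ x)

/-- The extension of a representation to the universal enveloping algebra. -/
def envelopingHom : UniversalEnvelopingAlgebra ℂ 𝔤 →ₐ[ℂ] Module.End ℂ W :=
  let _ : LieRing (Module.End ℂ W) := LieRing.ofAssociativeRing
  UniversalEnvelopingAlgebra.lift ℂ
    { toLinearMap := ρ
      map_lie' := fun {x y} => (hρ x y).trans (LieRing.of_associative_ring_bracket _ _).symm }

theorem envelopingHom_ι (x : 𝔤) :
    envelopingHom ρ hρ (UniversalEnvelopingAlgebra.ι ℂ x) = ρ x := by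
  let _ : LieRing (Module.End ℂ W) := LieRing.ofAssociativeRing
  exact UniversalEnvelopingAlgebra.lift_ι_apply ℂ _ x

variable (w₀ : W) (h₀ : ∀ p ∈ R, ρ p.1 w₀ = p.2 • w₀)

/-- The map out of the induced module determined by a vector that satisfies the relations. -/
def Ind.lift : Ind R →ₗ[ℂ] W :=
  let _ : Module (UniversalEnvelopingAlgebra ℂ 𝔤) W :=
    Module.compHom W (envelopingHom ρ hρ).toRingHom
  have hsmul : ∀ (u : UniversalEnvelopingAlgebra ℂ 𝔤) (w : W),
    u • w = envelopingHom ρ hρ u w := fun _ _ => rfl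
  let f : Ind R →ₗ[UniversalEnvelopingAlgebra ℂ 𝔤] W :=
    (relIdeal R).liftQ (LinearMap.toSpanSingleton (UniversalEnvelopingAlgebra ℂ 𝔤) W w₀) (by
      refine Submodule.span_le.mpr ?_
      rintro _ ⟨p, hp, rfl⟩
      simp only [SetLike.mem_coe, LinearMap.mem_ker, LinearMap.toSpanSingleton_apply]
      rw [hsmul, map_sub, LinearMap.sub_apply, envelopingHom_ι,
        AlgHom.commutes, h₀ p hp, Module.algebraMap_end_apply, sub_self])
  { toFun := f
    map_add' := map_add f
    map_smul' := fun t v => by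
      rw [← algebraMap_smul (UniversalEnvelopingAlgebra ℂ 𝔤) t v, map_smul, hsmul,
        AlgHom.commutes, Module.algebraMap_end_apply, RingHom.id_apply] }

theorem Ind.lift_mkQ (u : UniversalEnvelopingAlgebra ℂ 𝔤) :
    Ind.lift R ρ hρ w₀ h₀ ((relIdeal R).mkQ u) = envelopingHom ρ hρ u w₀ := rfl

theorem Ind.lift_gen : Ind.lift R ρ hρ w₀ h₀ (Ind.gen R) = w₀ :=
  (Ind.lift_mkQ R ρ hρ w₀ h₀ 1).trans (by rw [map_one, Module.End.one_apply])

theorem Ind.lift_lie (x : 𝔤) (v : Ind R) :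
    Ind.lift R ρ hρ w₀ h₀ ⁅x, v⁆ = ρ x (Ind.lift R ρ hρ w₀ h₀ v) := by
  obtain ⟨u, rfl⟩ := (relIdeal R).mkQ_surjective v
  refine (Ind.lift_mkQ R ρ hρ w₀ h₀ (UniversalEnvelopingAlgebra.ι ℂ x * u)).trans ?_
  rw [map_mul, envelopingHom_ι, Ind.lift_mkQ]
  rfl

end Induced


/-! ### Heisenberg relations on Fock modules -/

theorem form_comm (x y : Hyp) : form x y = form y x := by
  simp only [form]
  ring

theorem form_add_left (x y z : Hyp) : form (x + y) z = form x z + form y z := by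
  simp only [form, Pi.add_apply]
  ring

theorem HeisHat.mode_basis (i : Fin 2) (n : ℤ) :
    HeisHat.mode (hypBasis i) n = Finsupp.single (HeisGen.mode i n) (1 : ℂ) := by
  have h : ∀ a b c d : HeisGen →₀ ℂ, a = c → b = d → a + b = c + d := by rintro _ _ _ _ rfl rfl; rfl
  fin_cases i
  · refine (h _ _ (Finsupp.single (HeisGen.mode 0 n) 1) 0 ?_ ?_).trans (add_zero _) <;>
      simp [hypBasis]
  · refine (h _ _ 0 (Finsupp.single (HeisGen.mode 1 n) 1) ?_ ?_).trans (zero_add _) <;>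
      simp [hypBasis]

theorem HeisHat.mode_eq (x : Hyp) (n : ℤ) : HeisHat.mode x n =
    x 0 • HeisHat.mode (hypBasis 0) n + x 1 • HeisHat.mode (hypBasis 1) n := by
  rw [HeisHat.mode_basis, HeisHat.mode_basis]
  change (_ : HeisGen →₀ ℂ) = x 0 • (Finsupp.single (HeisGen.mode 0 n) (1 : ℂ))
    + x 1 • (Finsupp.single (HeisGen.mode 1 n) (1 : ℂ))
  rw [Finsupp.smul_single_one, Finsupp.smul_single_one]
  rfl

theorem HeisHat.induction {p : HeisHat → Prop} (zero : p 0)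
    (add : ∀ u v, p u → p v → p (u + v)) (mode : ∀ x n, p (HeisHat.mode x n))
    (c : ∀ t : ℂ, p (t • HeisHat.c)) (u : HeisHat) : p u := by
  induction u using Finsupp.induction_linear with
  | zero => exact zero
  | add u v hu hv => exact add u v hu hv
  | single g t =>
    cases g with
    | c =>
      have h := c t
      have e : t • HeisHat.c = (Finsupp.single HeisGen.c t : HeisGen →₀ ℂ) :=
        Finsupp.smul_single_one _ _
      rwa [e] at h
    | mode i n =>
      have h := mode (t • hypBasis i) n
      have e : HeisHat.mode (t • hypBasis i) n =
          (Finsupp.single (HeisGen.mode i n) t : HeisGen →₀ ℂ) := by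
        have e₁ : HeisHat.mode (t • hypBasis i) n = t • HeisHat.mode (hypBasis i) n := by
          rw [HeisHat.mode_eq (t • hypBasis i), HeisHat.mode_eq (hypBasis i)]
          simp only [Pi.smul_apply, smul_eq_mul]
          module
        rw [e₁, HeisHat.mode_basis]
        exact Finsupp.smul_single_one _ _
      rwa [e] at h

theorem HeisHat.lie_mode (x y : Hyp) (n m : ℤ) : ⁅HeisHat.mode x n, HeisHat.mode y m⁆ =
    (if n = -m then (n : ℂ) * form x y else 0) • HeisHat.c := by
  have key : ∀ i j : Fin 2, ⁅HeisHat.mode (hypBasis i) n, HeisHat.mode (hypBasis j) m⁆ =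
      (if n = -m then (n : ℂ) * form (hypBasis i) (hypBasis j) else 0) • HeisHat.c := by
    intro i j
    rw [HeisHat.mode_basis, HeisHat.mode_basis]
    exact bilinExt_single heisBr _ _
  rw [HeisHat.mode_eq x, HeisHat.mode_eq y]
  simp only [add_lie, lie_add, smul_lie, lie_smul, key]
  split_ifs
  · have e : form x y = x 0 * y 0 * form (hypBasis 0) (hypBasis 0)
        + x 0 * y 1 * form (hypBasis 0) (hypBasis 1)
        + x 1 * y 0 * form (hypBasis 1) (hypBasis 0)
        + x 1 * y 1 * form (hypBasis 1) (hypBasis 1) := by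
      simp [form, hypBasis]
      ring
    rw [e]
    module
  · simp

theorem HeisHat.lie_c (u : HeisHat) : ⁅u, HeisHat.c⁆ = 0 := by
  change bilinExt heisBr u (Finsupp.single HeisGen.c (1 : ℂ)) = 0
  induction u using Finsupp.induction_linear with
  | zero => simp
  | add u v hu hv => rw [map_add, LinearMap.add_apply, hu, hv, add_zero]
  | single g t => cases g <;> simp [bilinExt, heisBr]

/-- The element `c` is central, so its action and the identity are two intertwiners that agree on
the cyclic vector. -/
theorem c_lie (γ : Hyp) (w : M1 γ) : ⁅HeisHat.c, w⁆ = w := by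
  have h := Ind.hom_ext (fockRel γ) (fun x => LieModule.toEnd ℂ HeisHat (M1 γ) x)
    (LieModule.toEnd ℂ HeisHat (M1 γ) HeisHat.c) LinearMap.id
    ((Ind.lie_gen (fockRel γ) (p := (HeisHat.c, 1)) (Or.inr (Or.inr rfl))).trans (one_smul _ _))
    (fun x w => by
      simp only [LieModule.toEnd_apply_apply]
      rw [leibniz_lie, ← lie_skew, HeisHat.lie_c, neg_zero, zero_lie, zero_add])
    (fun x w => rfl)
  exact LinearMap.congr_fun h w

theorem modeOp_apply (γ x : Hyp) (n : ℤ) (w : M1 γ) :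
    modeOp γ x n w = ⁅HeisHat.mode x n, w⁆ := rfl

theorem modeOp_eq (γ x : Hyp) (n : ℤ) : modeOp γ x n =
    x 0 • modeOp γ (hypBasis 0) n + x 1 • modeOp γ (hypBasis 1) n := by
  simp only [modeOp]
  rw [HeisHat.mode_eq, map_add, map_smul, map_smul]

theorem modeOp_add (γ x y : Hyp) (n : ℤ) :
    modeOp γ (x + y) n = modeOp γ x n + modeOp γ y n := by
  rw [modeOp_eq γ x, modeOp_eq γ y, modeOp_eq γ (x + y), Pi.add_apply, Pi.add_apply]
  module

theorem modeOp_sub (γ x y : Hyp) (n : ℤ) :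
    modeOp γ (x - y) n = modeOp γ x n - modeOp γ y n := by
  rw [modeOp_eq γ x, modeOp_eq γ y, modeOp_eq γ (x - y), Pi.sub_apply, Pi.sub_apply]
  module

theorem modeOp_comm (γ x y : Hyp) (n m : ℤ) (w : M1 γ) :
    modeOp γ x n (modeOp γ y m w) = modeOp γ y m (modeOp γ x n w)
      + (if n = -m then (n : ℂ) * form x y else 0) • w := by
  simp only [modeOp_apply]
  rw [leibniz_lie, HeisHat.lie_mode, smul_lie, c_lie, add_comm]

theorem modeOp_comm_of_ne (γ x y : Hyp) {n m : ℤ} (h : n ≠ -m) (w : M1 γ) :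
    modeOp γ x n (modeOp γ y m w) = modeOp γ y m (modeOp γ x n w) := by
  rw [modeOp_comm, if_neg h, zero_smul, add_zero]

theorem M1.submodule_eq_top {γ : Hyp} (S : Submodule ℂ (M1 γ)) (hgen : expVec γ ∈ S)
    (hS : ∀ (x : Hyp) (n : ℤ), ∀ w ∈ S, modeOp γ x n w ∈ S) : S = ⊤ := by
  refine Ind.submodule_eq_top _ S hgen fun x w hw => ?_
  induction x using HeisHat.induction with
  | zero => rw [zero_lie]; exact S.zero_mem
  | add u v hu hv => rw [add_lie]; exact S.add_mem hu hv
  | c t => rw [smul_lie, c_lie]; exact S.smul_mem t hw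
  | mode x n => exact hS x n w hw

/-- The kernel is stable under all modes and contains a cyclic vector. This reduces an operator
identity whose defect commutes with the modes to its value on `e^γ`. -/
theorem M1.end_eq_zero {γ : Hyp} (D : Module.End ℂ (M1 γ)) (hgen : D (expVec γ) = 0)
    (hD : ∀ x n w, D (modeOp γ x n w) = modeOp γ x n (D w)) : D = 0 := by
  have h : LinearMap.ker D = ⊤ := by
    refine M1.submodule_eq_top _ hgen fun x n w hw => ?_
    rw [LinearMap.mem_ker] at hw ⊢
    rw [hD, hw, map_zero]
  exact LinearMap.ker_eq_top.mp h

theorem modeOp_zero (γ x : Hyp) : modeOp γ x 0 = form x γ • (1 : Module.End ℂ (M1 γ)) := by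
  rw [← sub_eq_zero]
  apply M1.end_eq_zero
  · rw [LinearMap.sub_apply, sub_eq_zero]
    exact Ind.lie_gen (fockRel γ) (p := (HeisHat.mode x 0, form x γ)) (Or.inr (Or.inl ⟨x, rfl⟩))
  · intro y n w
    simp only [LinearMap.sub_apply, LinearMap.smul_apply, Module.End.one_apply, map_sub, map_smul]
    rw [modeOp_comm]
    simp


/-! ### The polynomial model of a Fock module -/

/-- Polynomials in `I(-k-1)` (the variable `(false, k)`) and `J(-k-1)` (the variable `(true, k)`),
where `I = α + β` and `J = α - β`. -/
abbrev Poly : Type := MvPolynomial (Bool × ℕ) ℂ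

open MvPolynomial in
/-- The operator `x(n)` on polynomials. -/
def polyMode (γ x : Hyp) : ℤ → Module.End ℂ Poly
  | .ofNat 0 => form x γ • 1
  | .ofNat (k + 1) =>
      ((k : ℂ) + 1) • ((x 0 - x 1) • (pderiv (false, k)).toLinearMap
        + (x 0 + x 1) • (pderiv (true, k)).toLinearMap)
  | .negSucc k =>
      ((x 0 + x 1) / 2) • LinearMap.mulLeft ℂ (X (false, k))
        + ((x 0 - x 1) / 2) • LinearMap.mulLeft ℂ (X (true, k))

-- The commutator of two derivations is again a derivation, and this one kills every variable.
open MvPolynomial in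
theorem pderiv_comm (i j : Bool × ℕ) (p : Poly) :
    pderiv i (pderiv j p) = pderiv j (pderiv i p) := by
  have h : ⁅(pderiv i : Derivation ℂ Poly Poly), (pderiv j : Derivation ℂ Poly Poly)⁆ = 0 := by
    refine MvPolynomial.derivation_ext (fun k => ?_)
    rw [Derivation.commutator_apply, pderiv_X, pderiv_X]
    by_cases h₁ : i = k <;> by_cases h₂ : j = k <;> simp [h₁, h₂]
  have h' := congrArg (fun D => D p) h
  simp only [Derivation.commutator_apply, Derivation.coe_zero, Pi.zero_apply] at h'
  exact sub_eq_zero.mp h'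

theorem polyMode_zero (γ x : Hyp) (p : Poly) : polyMode γ x 0 p = form x γ • p := rfl

open MvPolynomial in
theorem polyMode_pos (γ x : Hyp) (k : ℕ) (p : Poly) : polyMode γ x ((k : ℤ) + 1) p =
    ((k : ℂ) + 1) • ((x 0 - x 1) • pderiv (false, k) p + (x 0 + x 1) • pderiv (true, k) p) := rfl

open MvPolynomial in
theorem polyMode_neg (γ x : Hyp) (k : ℕ) (p : Poly) : polyMode γ x (-((k : ℤ) + 1)) p =
    ((x 0 + x 1) / 2) • (X (false, k) * p) + ((x 0 - x 1) / 2) • (X (true, k) * p) := by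
  rw [← Int.negSucc_eq]
  rfl

theorem int_trichotomy (n : ℤ) :
    n = 0 ∨ (∃ k : ℕ, n = (k : ℤ) + 1) ∨ ∃ k : ℕ, n = -((k : ℤ) + 1) := by
  rcases lt_trichotomy n 0 with h | h | h
  · exact Or.inr (Or.inr ⟨(-n - 1).toNat, by omega⟩)
  · exact Or.inl h
  · exact Or.inr (Or.inl ⟨(n - 1).toNat, by omega⟩)

-- Only `∂X - X∂ = 1` contributes. The form appears through `(x₀ - x₁)(y₀ + y₁)/2 + (x₀ + x₁)(y₀ -
-- y₁)/2 = x₀y₀ - x₁y₁`.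
open MvPolynomial in
theorem polyMode_pos_neg_comm (γ x y : Hyp) (n m : ℕ) (p : Poly) :
    polyMode γ x ((n : ℤ) + 1) (polyMode γ y (-((m : ℤ) + 1)) p)
      = polyMode γ y (-((m : ℤ) + 1)) (polyMode γ x ((n : ℤ) + 1) p)
        + (if n = m then ((n : ℂ) + 1) * form x y else 0) • p := by
  have hX : ∀ (b b' : Bool) (q : Poly), pderiv (b, n) (X (b', m) * q) =
      X (b', m) * pderiv (b, n) q + (if b = b' ∧ n = m then (1 : ℂ) else 0) • q := by
    intro b b' q
    rw [pderiv_mul, pderiv_X, Pi.single_apply]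
    simp only [Prod.mk.injEq, eq_comm]
    split_ifs <;> simp [add_comm]
  simp only [polyMode_pos, polyMode_neg, map_add, map_smul, hX]
  split_ifs with h₁ h₂ <;> simp_all [form]
  all_goals module

theorem polyMode_comm (γ x y : Hyp) (n m : ℤ) (p : Poly) :
    polyMode γ x n (polyMode γ y m p) = polyMode γ y m (polyMode γ x n p)
      + (if n = -m then (n : ℂ) * form x y else 0) • p := by
  rcases int_trichotomy n with rfl | ⟨n, rfl⟩ | ⟨n, rfl⟩
  · simp [polyMode_zero]
  · rcases int_trichotomy m with rfl | ⟨m, rfl⟩ | ⟨m, rfl⟩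
    · rw [if_neg (by omega)]
      simp [polyMode_zero]
    · rw [if_neg (by omega)]
      simp only [polyMode_pos, map_add, map_smul, pderiv_comm _ (_, n)]
      module
    · rw [polyMode_pos_neg_comm]
      congr 2
      split_ifs <;> first | omega | simp
  · rcases int_trichotomy m with rfl | ⟨m, rfl⟩ | ⟨m, rfl⟩
    · rw [if_neg (by omega)]
      simp [polyMode_zero]
    · rw [polyMode_pos_neg_comm, add_assoc, ← add_smul]
      rw [left_eq_add, form_comm y x]
      split_ifs with h₁ h₂ h₂
      · subst h₁
        push_cast
        module
      · omega
      · omega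
      · simp
    · rw [if_neg (by omega)]
      simp only [polyMode_neg, mul_add, mul_smul_comm, smul_add,
        mul_left_comm (MvPolynomial.X (_, m) : Poly)]
      module

/-- The operators on polynomials assigned to the basis elements of `ĥ`. -/
def polyGen (γ : Hyp) : HeisGen → Module.End ℂ Poly
  | .mode i n => polyMode γ (hypBasis i) n
  | .c => 1

/-- The action of `ĥ` on polynomials. -/
def polyAction (γ : Hyp) : HeisHat →ₗ[ℂ] Module.End ℂ Poly :=
  Finsupp.linearCombination ℂ (polyGen γ)

theorem polyAction_c (γ : Hyp) : polyAction γ HeisHat.c = 1 :=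
  (Finsupp.linearCombination_single ℂ _ _).trans (one_smul _ _)

theorem polyAction_basis (γ : Hyp) (i : Fin 2) (n : ℤ) :
    polyAction γ (HeisHat.mode (hypBasis i) n) = polyMode γ (hypBasis i) n := by
  rw [HeisHat.mode_basis]
  exact (Finsupp.linearCombination_single ℂ _ _).trans (one_smul _ _)

theorem polyAction_mode (γ x : Hyp) (n : ℤ) :
    polyAction γ (HeisHat.mode x n) = polyMode γ x n := by
  rw [HeisHat.mode_eq, map_add, map_smul, map_smul, polyAction_basis, polyAction_basis]
  refine LinearMap.ext fun p => ?_
  rcases int_trichotomy n with rfl | ⟨n, rfl⟩ | ⟨n, rfl⟩ <;>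
    simp only [LinearMap.add_apply, LinearMap.smul_apply, polyMode_zero, polyMode_pos,
      polyMode_neg, form, hypBasis, Pi.single_apply, Fin.isValue, zero_ne_one, one_ne_zero,
      if_true, if_false] <;> module

theorem polyAction_lie (γ : Hyp) (u v : HeisHat) : polyAction γ ⁅u, v⁆ =
    polyAction γ u * polyAction γ v - polyAction γ v * polyAction γ u := by
  refine linearCombination_bilinExt heisBr (polyGen γ) (fun x y => ?_) u v
  refine LinearMap.ext fun p => ?_
  cases x <;> cases y <;> simp only [heisBr, map_zero, polyGen, one_mul, mul_one, sub_self]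
  rw [map_smul, Finsupp.linearCombination_single, LinearMap.sub_apply, Module.End.mul_apply,
    Module.End.mul_apply, polyMode_comm]
  rw [add_sub_cancel_left, polyGen, one_smul]
  rfl

theorem polyAction_rel (γ : Hyp) :
    ∀ p ∈ fockRel γ, polyAction γ p.1 (1 : Poly) = p.2 • (1 : Poly) := by
  rintro _ (⟨x, n, hn, rfl⟩ | ⟨x, rfl⟩ | rfl)
  · obtain ⟨k, rfl⟩ : ∃ k : ℕ, n = (k : ℤ) + 1 := ⟨(n - 1).toNat, by omega⟩
    rw [polyAction_mode, polyMode_pos]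
    simp
  · rw [polyAction_mode, polyMode_zero]
  · rw [polyAction_c]
    simp

/-- The comparison of a Fock module with polynomials. -/
def toPoly (γ : Hyp) : M1 γ →ₗ[ℂ] Poly :=
  Ind.lift (fockRel γ) (polyAction γ) (polyAction_lie γ) 1 (polyAction_rel γ)

theorem toPoly_expVec (γ : Hyp) : toPoly γ (expVec γ) = 1 := Ind.lift_gen _ _ _ _ _

theorem toPoly_mode (γ x : Hyp) (n : ℤ) (w : M1 γ) :
    toPoly γ (modeOp γ x n w) = polyMode γ x n (toPoly γ w) := by
  rw [← polyAction_mode]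
  exact Ind.lift_lie _ _ _ _ _ _ _

/-- The vector `I = α + β` of `𝔥` for `false`, and `J = α - β` for `true`. -/
def lightVec : Bool → Hyp
  | false => alpha + beta
  | true => alpha - beta

/-- The creation operators `I(-k-1)` and `J(-k-1)`. -/
def creation (γ : Hyp) (i : Bool × ℕ) : Module.End ℂ (M1 γ) :=
  modeOp γ (lightVec i.1) (-((i.2 : ℤ) + 1))

theorem polyMode_creation (γ : Hyp) (i : Bool × ℕ) (p : Poly) :
    polyMode γ (lightVec i.1) (-((i.2 : ℤ) + 1)) p = MvPolynomial.X i * p := by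
  rw [polyMode_neg]
  rcases i with ⟨_ | _, k⟩ <;> simp [lightVec, alpha, beta, hypBasis]

theorem toPoly_creation (γ : Hyp) (i : Bool × ℕ) (w : M1 γ) :
    toPoly γ (creation γ i w) = MvPolynomial.X i * toPoly γ w := by
  rw [creation, toPoly_mode, polyMode_creation]

theorem creation_comm (γ : Hyp) (i j : Bool × ℕ) :
    creation γ i * creation γ j = creation γ j * creation γ i := by
  ext1 w
  exact modeOp_comm_of_ne _ _ _ (by omega) w

/-- The inverse of `toPoly`: substitute the creation operators for the variables and apply the
result to `e^γ`. -/
theorem exists_fromPoly (γ : Hyp) : ∃ F : Poly →ₗ[ℂ] M1 γ, F 1 = expVec γ ∧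
    ∀ i p, F (MvPolynomial.X i * p) = creation γ i (F p) := by
  -- `MvPolynomial.aeval` needs a commutative target, so evaluation takes place in the subalgebra
  -- generated by the commuting creation operators.
  have : IsMulCommutative (Algebra.adjoin ℂ (Set.range (creation γ))) :=
    Algebra.isMulCommutative_adjoin ℂ (by
      rintro _ ⟨i, rfl⟩ _ ⟨j, rfl⟩
      exact creation_comm γ i j)
  open scoped IsMulCommutative in
  let E : Poly →ₐ[ℂ] Module.End ℂ (M1 γ) :=
    (Algebra.adjoin ℂ (Set.range (creation γ))).val.comp
      (MvPolynomial.aeval fun i => ⟨creation γ i, Algebra.subset_adjoin ⟨i, rfl⟩⟩)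
  refine ⟨LinearMap.applyₗ (expVec γ) ∘ₗ E.toLinearMap, ?_, fun i p => ?_⟩
  · simp
  · simp [E]

theorem modeOp_neg (γ x : Hyp) (k : ℕ) : modeOp γ x (-((k : ℤ) + 1)) =
    ((x 0 + x 1) / 2) • creation γ (false, k) + ((x 0 - x 1) / 2) • creation γ (true, k) := by
  rw [creation, creation, lightVec, lightVec, modeOp_add, modeOp_sub, modeOp_eq, alpha, beta]
  module

/-- On both sides a mode passes a creation operator at the cost of the same scalar, which reduces
the claim to the constant polynomial. -/
theorem fromPoly_mode {γ : Hyp} {F : Poly →ₗ[ℂ] M1 γ} (hF₁ : F 1 = expVec γ)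
    (hF : ∀ i p, F (MvPolynomial.X i * p) = creation γ i (F p)) (x : Hyp) (n : ℤ) (p : Poly) :
    F (polyMode γ x n p) = modeOp γ x n (F p) := by
  induction p using MvPolynomial.induction_on with
  | C t =>
    rw [MvPolynomial.C_eq_smul_one, map_smul, map_smul, map_smul, map_smul, hF₁]
    congr 1
    rcases int_trichotomy n with rfl | ⟨n, rfl⟩ | ⟨n, rfl⟩
    · rw [polyMode_zero, map_smul, hF₁, modeOp_zero]
      rfl
    · rw [polyMode_pos, modeOp_expVec γ x _ (by omega)]
      simp
    · rw [polyMode_neg, modeOp_neg, map_add, map_smul, map_smul, hF, hF, hF₁]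
      rfl
  | add p q hp hq => rw [map_add, map_add, map_add, map_add, hp, hq]
  | mul_X p i hp =>
    rw [mul_comm, hF, creation, modeOp_comm, ← polyMode_creation γ, polyMode_comm, map_add,
      polyMode_creation, hF, hp, map_smul]
    rfl

/-- The map `F` from polynomials is onto because its range is a submodule containing `e^γ`, and
`toPoly ∘ F = id`; together these make `toPoly` bijective. -/
theorem toPoly_bijective (γ : Hyp) : Function.Bijective (toPoly γ) := by
  obtain ⟨F, hF₁, hF⟩ := exists_fromPoly γ
  have hFr : LinearMap.range F = ⊤ := by
    apply M1.submodule_eq_top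
    · exact ⟨1, hF₁⟩
    · rintro x n _ ⟨p, rfl⟩
      exact ⟨_, fromPoly_mode hF₁ hF x n p⟩
  have hid : ∀ p, toPoly γ (F p) = p := by
    intro p
    induction p using MvPolynomial.induction_on with
    | C t =>
      rw [MvPolynomial.C_eq_smul_one, map_smul, map_smul, hF₁, toPoly_expVec]
    | add p q hp hq => rw [map_add, map_add, hp, hq]
    | mul_X p i hp => rw [mul_comm, hF, toPoly_creation, hp]
  refine ⟨?_, fun p => ⟨F p, hid p⟩⟩
  intro v w h
  obtain ⟨p, rfl⟩ := LinearMap.range_eq_top.mp hFr v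
  obtain ⟨q, rfl⟩ := LinearMap.range_eq_top.mp hFr w
  rw [hid, hid] at h
  rw [h]

/-- The coefficient of the highest weight vector. -/
def vacCoeff (γ : Hyp) : M1 γ →ₗ[ℂ] ℂ :=
  MvPolynomial.lcoeff ℂ 0 ∘ₗ toPoly γ

theorem vacCoeff_apply (γ : Hyp) (w : M1 γ) :
    vacCoeff γ w = MvPolynomial.coeff 0 (toPoly γ w) := rfl

theorem vacCoeff_expVec (γ : Hyp) : vacCoeff γ (expVec γ) = 1 := by
  rw [vacCoeff_apply, toPoly_expVec, MvPolynomial.coeff_zero_one]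

theorem vacCoeff_mode_neg (γ x : Hyp) {n : ℤ} (hn : n < 0) (w : M1 γ) :
    vacCoeff γ (modeOp γ x n w) = 0 := by
  obtain ⟨k, rfl⟩ : ∃ k : ℕ, n = -((k : ℤ) + 1) := ⟨(-n - 1).toNat, by omega⟩
  rw [vacCoeff_apply, toPoly_mode, polyMode_neg]
  simp [MvPolynomial.coeff_X_mul']

/-- A vector killed by all annihilation operators is a multiple of the highest weight vector. -/
theorem eq_zero_of_vacCoeff {γ : Hyp} {v : M1 γ} (h : ∀ x n, 0 < n → modeOp γ x n v = 0)
    (h₀ : vacCoeff γ v = 0) : v = 0 := by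
  have hd : ∀ i, MvPolynomial.pderiv i (toPoly γ v) = 0 := by
    rintro ⟨b, k⟩
    -- Both `I` and `J` are isotropic and pair only with each other, so the derivative in an
    -- `I`-variable is a multiple of an annihilation mode of `J`, and conversely.
    have h₁ := congrArg (toPoly γ) (h (lightVec (!b)) ((k : ℤ) + 1) (by omega))
    rw [toPoly_mode, polyMode_pos, map_zero] at h₁
    have hk : ((k : ℂ) + 1) ≠ 0 := Nat.cast_add_one_ne_zero k
    have h₂ := (smul_eq_zero.mp h₁).resolve_left hk
    cases b <;> norm_num [lightVec, alpha, beta, hypBasis] at h₂ <;> exact h₂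
  apply (toPoly_bijective γ).1
  rw [map_zero]
  ext m
  rw [MvPolynomial.coeff_zero]
  by_cases hm : m = 0
  · rw [hm]
    exact h₀
  · obtain ⟨i, hi⟩ := Finsupp.ne_iff.mp hm
    rw [Finsupp.zero_apply] at hi
    have h₁ := congrArg (MvPolynomial.coeff (m - Finsupp.single i 1)) (hd i)
    rw [MvPolynomial.coeff_pderiv, MvPolynomial.coeff_zero] at h₁
    have h₂ : m - Finsupp.single i 1 + Finsupp.single i 1 = m :=
      tsub_add_cancel_of_le (Finsupp.single_le_iff.mpr (Nat.one_le_iff_ne_zero.mpr hi))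
    rw [h₂] at h₁
    exact (mul_eq_zero.mp h₁).resolve_right (Nat.cast_add_one_ne_zero _)


/-! ### The Virasoro operators on Fock modules -/

theorem normOrd_of_ne (γ x : Hyp) {j k : ℤ} (h : j ≠ -k) (w : M1 γ) :
    normOrd γ x j k w = modeOp γ x j (modeOp γ x k w) := by
  rw [normOrd]
  split_ifs
  · rfl
  · exact modeOp_comm_of_ne γ x x (by omega) w

/-- Commutators of modes are scalars, so both orderings of the product give the same two correction
terms. -/
theorem normOrd_mode (γ x y : Hyp) (j k m : ℤ) (w : M1 γ) :
    normOrd γ x j k (modeOp γ y m w) = modeOp γ y m (normOrd γ x j k w)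
      + ((if k = -m then (k : ℂ) * form x y else 0) • modeOp γ x j w
        + (if j = -m then (j : ℂ) * form x y else 0) • modeOp γ x k w) := by
  rw [normOrd]
  split_ifs <;> simp only [Module.End.mul_apply] <;>
    rw [modeOp_comm γ x y, map_add, modeOp_comm γ x y, map_smul] <;> simp [*] <;> abel

theorem quadOp_apply (γ x : Hyp) (n : ℤ) (w : M1 γ) :
    quadOp γ x n w = ∑ᶠ k : ℤ, normOrd γ x (n - k) k w := rfl

/-- Each of the two corrections from `normOrd_mode` is nonzero for at most one summation index, `k =
-m` or `k = n + m`, and contributes half of the coefficient `-2m⟨x, y⟩`. -/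
theorem quadOp_mode (γ x y : Hyp) (n m : ℤ) (w : M1 γ) :
    quadOp γ x n (modeOp γ y m w) = modeOp γ y m (quadOp γ x n w)
      + (-2 * (m : ℂ) * form x y) • modeOp γ x (n + m) w := by
  have h₁ : ∑ᶠ k : ℤ, (if k = -m then (k : ℂ) * form x y else 0) • modeOp γ x (n - k) w =
      (-(m : ℂ) * form x y) • modeOp γ x (n + m) w := by
    rw [finsum_eq_single _ (-m) (fun k hk => by rw [if_neg hk, zero_smul])]
    simp
  have h₂ : ∑ᶠ k : ℤ, (if n - k = -m then ((n - k : ℤ) : ℂ) * form x y else 0) • modeOp γ x k w =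
      (-(m : ℂ) * form x y) • modeOp γ x (n + m) w := by
    rw [finsum_eq_single _ (n + m) (fun k hk => by rw [if_neg (by omega), zero_smul])]
    simp
  have hf₁ : (Function.support fun k : ℤ =>
      (if k = -m then (k : ℂ) * form x y else 0) • modeOp γ x (n - k) w).Finite :=
    (Set.finite_singleton (-m)).subset fun k hk => by
      by_contra h
      exact hk ((congrArg (· • _) (if_neg h)).trans (zero_smul _ _))
  have hf₂ : (Function.support fun k : ℤ =>
      (if n - k = -m then ((n - k : ℤ) : ℂ) * form x y else 0) • modeOp γ x k w).Finite :=
    (Set.finite_singleton (n + m)).subset fun k hk => by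
      by_contra h
      rw [Set.mem_singleton_iff] at h
      exact hk ((congrArg (· • _) (if_neg (by omega))).trans (zero_smul _ _))
  have hfin := normOrd_finite γ x n w
  rw [quadOp_apply, quadOp_apply]
  have e : (modeOp γ y m) (∑ᶠ k : ℤ, normOrd γ x (n - k) k w) =
      ∑ᶠ k : ℤ, modeOp γ y m (normOrd γ x (n - k) k w) :=
    (modeOp γ y m).toAddMonoidHom.map_finsum hfin
  rw [e, finsum_congr fun k => normOrd_mode γ x y (n - k) k m w, finsum_add_distrib,
    finsum_add_distrib hf₁ hf₂, h₁, h₂]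
  · module
  · exact hfin.subset fun k hk h => hk ((congrArg _ h).trans (map_zero _))
  · exact (hf₁.union hf₂).subset (Function.support_add _ _)

theorem fockL_apply (lam mu : ℂ) (γ : Hyp) (n : ℤ) (w : M1 γ) : fockL lam mu γ n w =
    (1 / 2 : ℂ) • quadOp γ alpha n w - (1 / 2 : ℂ) • quadOp γ beta n w
      - ((n : ℂ) + 1) • (lam • modeOp γ alpha n w + mu • modeOp γ beta n w) := rfl

/-- The pairing with `λ α + μ β`. -/
def bgCharge (lam mu : ℂ) (y : Hyp) : ℂ := lam * form alpha y + mu * form beta y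

theorem fockL_mode (lam mu : ℂ) (γ y : Hyp) (n m : ℤ) (w : M1 γ) :
    fockL lam mu γ n (modeOp γ y m w) = modeOp γ y m (fockL lam mu γ n w)
      + (-(m : ℂ)) • modeOp γ y (n + m) w
      - (if n = -m then (n : ℂ) * (n + 1) * bgCharge lam mu y else 0) • w := by
  -- Expansion of `y` in the orthogonal basis; the minus sign comes from `⟨β, β⟩ = -1`.
  have e : modeOp γ y (n + m) w = form alpha y • modeOp γ alpha (n + m) w
      - form beta y • modeOp γ beta (n + m) w := by
    rw [modeOp_eq γ y]
    simp [form, alpha, beta, hypBasis]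
  rw [fockL_apply, fockL_apply, quadOp_mode, quadOp_mode, modeOp_comm γ alpha y,
    modeOp_comm γ beta y, e]
  simp only [map_add, map_sub, map_smul, bgCharge]
  split_ifs <;> module

/-- The defect of the Virasoro relation commutes with every Heisenberg mode, whatever scalar `t` is
used. The central charge is therefore still undetermined here and must be found on `e^γ`. -/
theorem fockL_bracket_mode (lam mu : ℂ) (γ y : Hyp) (m n k : ℤ) (w : M1 γ) (t : ℂ) :
    (fockL lam mu γ m * fockL lam mu γ n - fockL lam mu γ n * fockL lam mu γ m
      - ((m : ℂ) - n) • fockL lam mu γ (m + n) - t • 1) (modeOp γ y k w) =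
    modeOp γ y k ((fockL lam mu γ m * fockL lam mu γ n - fockL lam mu γ n * fockL lam mu γ m
      - ((m : ℂ) - n) • fockL lam mu γ (m + n) - t • 1) w) := by
  simp only [LinearMap.sub_apply, LinearMap.smul_apply, Module.End.mul_apply, Module.End.one_apply,
    fockL_mode, map_add, map_sub, map_smul]
  have e₁ : n + (m + k) = m + n + k := by ring
  have e₂ : m + (n + k) = m + n + k := by ring
  rw [e₁, e₂]
  by_cases h : m + n + k = 0
  · obtain rfl : k = -m - n := by omega
    have c₁ : m = -(n + (-m - n)) := by ring
    have c₂ : n = -(m + (-m - n)) := by ring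
    have c₃ : m + n = -(-m - n) := by ring
    rw [if_pos c₁, if_pos c₂, if_pos c₃]
    push_cast
    module
  · have c₁ : ¬m = -(n + k) := by omega
    have c₂ : ¬n = -(m + k) := by omega
    have c₃ : ¬m + n = -k := by omega
    rw [if_neg c₁, if_neg c₂, if_neg c₃]
    push_cast
    module

/-! ### Quadratic and Virasoro operators on the highest weight vector -/

theorem normOrd_expVec_eq_zero (γ x : Hyp) {j k : ℤ} (h : 0 < j ∨ 0 < k) :
    normOrd γ x j k (expVec γ) = 0 := by
  rw [normOrd]
  split_ifs
  · rw [Module.End.mul_apply, modeOp_expVec _ _ _ (by omega), map_zero]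
  · rw [Module.End.mul_apply, modeOp_expVec _ _ _ (by omega), map_zero]

theorem quadOp_expVec_pos (γ x : Hyp) {n : ℤ} (hn : 0 < n) : quadOp γ x n (expVec γ) = 0 := by
  rw [quadOp_apply, finsum_congr fun k => normOrd_expVec_eq_zero γ x (by omega), finsum_zero]

theorem quadOp_expVec_zero (γ x : Hyp) :
    quadOp γ x 0 (expVec γ) = (form x γ) ^ 2 • expVec γ := by
  rw [quadOp_apply, finsum_eq_single _ 0 fun k hk => normOrd_expVec_eq_zero γ x (by omega)]
  simp only [normOrd, sub_zero, le_refl, if_true, modeOp_zero, Module.End.mul_apply,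
    LinearMap.smul_apply, Module.End.one_apply]
  module

/-- Only the indices `-(p+1) ≤ k ≤ 0` survive on `e^γ`. At the two ends one factor is `x(0)`, which
gives the coefficient `2⟨x, γ⟩`; the `p` interior terms form the sum. -/
theorem quadOp_expVec_neg (γ x : Hyp) (p : ℕ) : quadOp γ x (-((p : ℤ) + 1)) (expVec γ) =
    (2 * form x γ) • modeOp γ x (-((p : ℤ) + 1)) (expVec γ)
      + ∑ j ∈ Finset.range p,
        modeOp γ x (-((j : ℤ) + 1)) (modeOp γ x ((j : ℤ) - p) (expVec γ)) := by
  -- The shift `j ↦ j - (p+1)` carries `0, …, p+1` onto the `p + 2` surviving indices.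
  have hinj : Function.Injective fun j : ℕ => (j : ℤ) - (p + 1) := fun a b h => by
    simpa using h
  rw [quadOp_apply, finsum_eq_sum_of_support_subset (s := (Finset.range (p + 2)).map ⟨_, hinj⟩)]
  · rw [Finset.sum_map, Finset.sum_range_succ, Finset.sum_range_succ']
    simp only [Function.Embedding.coeFn_mk]
    rw [normOrd_of_ne γ x (by push_cast; omega), normOrd_of_ne γ x (by push_cast; omega)]
    have e : ∀ j ∈ Finset.range p,
        normOrd γ x (-((p : ℤ) + 1) - (((j + 1 : ℕ) : ℤ) - (p + 1))) (((j + 1 : ℕ) : ℤ) - (p + 1))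
          (expVec γ) = modeOp γ x (-((j : ℤ) + 1)) (modeOp γ x ((j : ℤ) - p) (expVec γ)) := by
      intro j _
      rw [normOrd_of_ne γ x (by push_cast; omega)]
      have e₁ : -((p : ℤ) + 1) - (((j + 1 : ℕ) : ℤ) - (p + 1)) = -((j : ℤ) + 1) := by
        push_cast
        ring
      have e₂ : (((j + 1 : ℕ) : ℤ) - (p + 1)) = (j : ℤ) - p := by
        push_cast
        ring
      rw [e₁, e₂]
    rw [Finset.sum_congr rfl e]
    have e₁ : -((p : ℤ) + 1) - (((0 : ℕ) : ℤ) - (p + 1)) = 0 := by push_cast; ring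
    have e₂ : ((0 : ℕ) : ℤ) - (p + 1) = -((p : ℤ) + 1) := by push_cast; ring
    have e₃ : ((p + 1 : ℕ) : ℤ) - (p + 1) = 0 := by push_cast; ring
    rw [e₁, e₂, e₃, sub_zero, modeOp_zero]
    simp only [LinearMap.smul_apply, Module.End.one_apply, map_smul]
    module
  · intro k hk
    have h : ¬(0 < -((p : ℤ) + 1) - k ∨ 0 < k) := fun h => hk (normOrd_expVec_eq_zero γ x h)
    simp only [Finset.coe_map, Function.Embedding.coeFn_mk, Set.mem_image, Finset.mem_coe,
      Finset.mem_range]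
    exact ⟨(k + (p + 1)).toNat, by omega, by omega⟩

/-- The eigenvalue of `L(0)` on `e^γ`. -/
def weight (lam mu : ℂ) (γ : Hyp) : ℂ :=
  (form alpha γ ^ 2 - form beta γ ^ 2) / 2 - (lam * form alpha γ + mu * form beta γ)

theorem fockL_expVec_pos (lam mu : ℂ) (γ : Hyp) {n : ℤ} (hn : 0 < n) :
    fockL lam mu γ n (expVec γ) = 0 := by
  rw [fockL_apply, quadOp_expVec_pos γ _ hn, quadOp_expVec_pos γ _ hn,
    modeOp_expVec _ _ _ hn, modeOp_expVec _ _ _ hn]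
  simp

theorem fockL_expVec_zero (lam mu : ℂ) (γ : Hyp) :
    fockL lam mu γ 0 (expVec γ) = weight lam mu γ • expVec γ := by
  rw [fockL_apply, quadOp_expVec_zero, quadOp_expVec_zero, modeOp_zero, modeOp_zero]
  simp only [LinearMap.smul_apply, Module.End.one_apply, weight]
  push_cast
  module

/-! ### Vacuum coefficients and the Virasoro relation -/

theorem vacCoeff_normOrd (γ x : Hyp) {j k : ℤ} (h : j < 0 ∨ k < 0) (hjk : j + k ≤ 0) (w : M1 γ) :
    vacCoeff γ (normOrd γ x j k w) = 0 := by
  rw [normOrd]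
  split_ifs <;> exact vacCoeff_mode_neg _ _ (by omega) _

theorem vacCoeff_quadOp (γ x : Hyp) (n : ℤ) (w : M1 γ) : vacCoeff γ (quadOp γ x n w) =
    ∑ᶠ k : ℤ, vacCoeff γ (normOrd γ x (n - k) k w) :=
  (vacCoeff γ).toAddMonoidHom.map_finsum (normOrd_finite γ x n w)

theorem vacCoeff_fockL_neg (lam mu : ℂ) (γ : Hyp) {n : ℤ} (hn : n < 0) (w : M1 γ) :
    vacCoeff γ (fockL lam mu γ n w) = 0 := by
  have h : ∀ x, vacCoeff γ (quadOp γ x n w) = 0 := fun x => by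
    rw [vacCoeff_quadOp, finsum_congr fun k => vacCoeff_normOrd γ x (by omega) (by omega) w,
      finsum_zero]
  rw [fockL_apply]
  simp only [map_sub, map_smul, map_add, h, vacCoeff_mode_neg γ _ hn]
  simp

theorem vacCoeff_fockL_zero (lam mu : ℂ) (γ : Hyp) (w : M1 γ) :
    vacCoeff γ (fockL lam mu γ 0 w) = weight lam mu γ * vacCoeff γ w := by
  have h : ∀ x, vacCoeff γ (quadOp γ x 0 w) = form x γ ^ 2 * vacCoeff γ w := fun x => by
    rw [vacCoeff_quadOp,
      finsum_eq_single _ 0 fun k hk => vacCoeff_normOrd γ x (by omega) (by omega) w]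
    simp only [normOrd, sub_zero, le_refl, if_true, modeOp_zero, Module.End.mul_apply,
      LinearMap.smul_apply, Module.End.one_apply, map_smul, smul_eq_mul]
    ring
  rw [fockL_apply]
  simp only [map_sub, map_smul, map_add, h, modeOp_zero, LinearMap.smul_apply,
    Module.End.one_apply, smul_eq_mul, weight]
  push_cast
  ring

theorem vacCoeff_fockL_expVec (lam mu : ℂ) (γ : Hyp) (n : ℤ) :
    vacCoeff γ (fockL lam mu γ n (expVec γ)) = if n = 0 then weight lam mu γ else 0 := by
  rcases lt_trichotomy n 0 with h | rfl | h
  · rw [vacCoeff_fockL_neg _ _ _ h, if_neg h.ne]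
  · rw [vacCoeff_fockL_zero, vacCoeff_expVec, if_pos rfl, mul_one]
  · rw [fockL_expVec_pos _ _ _ h, if_neg h.ne', map_zero]

theorem vacCoeff_mode_expVec (γ x : Hyp) (n : ℤ) :
    vacCoeff γ (modeOp γ x n (expVec γ)) = if n = 0 then form x γ else 0 := by
  rcases lt_trichotomy n 0 with h | rfl | h
  · rw [vacCoeff_mode_neg _ _ h, if_neg h.ne]
  · simp [modeOp_zero, vacCoeff_expVec]
  · rw [modeOp_expVec _ _ _ h, if_neg h.ne', map_zero]

theorem vacCoeff_fockL_mode (lam mu : ℂ) (γ x : Hyp) {m n : ℤ} (hm : 0 < m) (hn : 0 < n) :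
    vacCoeff γ (fockL lam mu γ m (modeOp γ x (-n) (expVec γ))) =
      if m = n then (n : ℂ) * form x γ - n * (n + 1) * bgCharge lam mu x else 0 := by
  rw [fockL_mode, fockL_expVec_pos _ _ _ hm]
  simp only [map_sub, map_add, map_smul, map_zero, vacCoeff_mode_expVec, vacCoeff_expVec, neg_neg]
  by_cases h : m = n
  · subst h
    simp
  · rw [if_neg h, if_neg h, if_neg (by omega)]
    simp

theorem vacCoeff_fockL_mode_mode (lam mu : ℂ) (γ x : Hyp) {m j k : ℤ} (hj : 0 < j) (hk : 0 < k) :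
    vacCoeff γ (fockL lam mu γ m (modeOp γ x (-j) (modeOp γ x (-k) (expVec γ)))) =
      if m = j + k then (j : ℂ) * k * form x x else 0 := by
  rw [fockL_mode]
  simp only [map_sub, map_add, map_smul, vacCoeff_mode_neg γ x (neg_neg_of_pos hj),
    vacCoeff_mode_neg γ x (neg_neg_of_pos hk)]
  rw [modeOp_comm, map_add, map_smul, vacCoeff_mode_neg γ x (neg_neg_of_pos hk), vacCoeff_expVec]
  by_cases h : m = j + k
  · subst h
    simp
    ring
  · rw [if_neg h, if_neg (by omega)]
    simp

/-- Keeping `q` independent of the length `p` is what lets the induction run. At `q = p` the value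
is `p(p+1)(p+2)/6`, the source of the cubic central term. -/
theorem sum_range_mul_sub (p : ℕ) (q : ℂ) :
    ∑ j ∈ Finset.range p, ((j : ℂ) + 1) * (q - j) =
      q * p * (p + 1) / 2 - (p - 1) * p * (p + 1) / 3 := by
  induction p with
  | zero => simp
  | succ p ih =>
    rw [Finset.sum_range_succ, ih]
    push_cast
    ring

theorem vacCoeff_fockL_quadOp (lam mu : ℂ) (γ x : Hyp) {m : ℤ} (hm : 0 < m) (p : ℕ) :
    vacCoeff γ (fockL lam mu γ m (quadOp γ x (-((p : ℤ) + 1)) (expVec γ))) =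
      if m = (p : ℤ) + 1 then
        2 * form x γ * (((p : ℂ) + 1) * form x γ - (p + 1) * (p + 2) * bgCharge lam mu x)
          + p * (p + 1) * (p + 2) / 6 * form x x
      else 0 := by
  rw [quadOp_expVec_neg, map_add, map_add, map_smul, map_smul, map_sum, map_sum,
    vacCoeff_fockL_mode _ _ _ _ hm (by omega)]
  have e : ∀ j ∈ Finset.range p, vacCoeff γ (fockL lam mu γ m
      (modeOp γ x (-((j : ℤ) + 1)) (modeOp γ x ((j : ℤ) - p) (expVec γ)))) =
      if m = (p : ℤ) + 1 then ((j : ℂ) + 1) * (p - j) * form x x else 0 := by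
    intro j hj
    rw [Finset.mem_range] at hj
    have := vacCoeff_fockL_mode_mode lam mu γ x (m := m) (j := (j : ℤ) + 1) (k := p - j)
      (by omega) (by omega)
    rw [neg_sub] at this
    rw [this]
    have e' : (j : ℤ) + 1 + (p - j) = p + 1 := by ring
    rw [e']
    push_cast
    rfl
  rw [Finset.sum_congr rfl e]
  split_ifs
  · rw [← Finset.sum_mul, sum_range_mul_sub]
    push_cast
    rw [smul_eq_mul]
    ring
  · simp

/-- This is where the central charge is computed. The bosons `α` and `β` contribute `1` each, since
the sign of `⟨β, β⟩` cancels the sign of the quadratic term. The part `-12(λ² - μ²)` comes from the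
linear term of `L(-m)` meeting the scalar term of `[L(m), y(-m)]`. -/
theorem vacCoeff_fockL_fockL (lam mu : ℂ) (γ : Hyp) {m : ℤ} (hm : 0 < m) (p : ℕ) :
    vacCoeff γ (fockL lam mu γ m (fockL lam mu γ (-((p : ℤ) + 1)) (expVec γ))) =
      if m = (p : ℤ) + 1 then 2 * (m : ℂ) * weight lam mu γ
        + ((m : ℂ) ^ 3 - m) / 12 * (2 - 12 * (lam ^ 2 - mu ^ 2)) else 0 := by
  rw [fockL_apply lam mu γ (-((p : ℤ) + 1))]
  simp only [map_add, map_sub, map_smul, vacCoeff_fockL_quadOp _ _ _ _ hm,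
    vacCoeff_fockL_mode _ _ _ _ hm (by omega : (0 : ℤ) < p + 1)]
  split_ifs with h
  · subst h
    have h₁ : form alpha alpha = 1 := by simp [form, alpha, hypBasis]
    have h₂ : form beta beta = -1 := by simp [form, beta, hypBasis]
    have h₃ : form alpha beta = 0 := by simp [form, alpha, beta, hypBasis]
    simp only [bgCharge, weight, form_comm beta alpha, h₁, h₂, h₃, smul_eq_mul]
    push_cast
    ring
  · simp

/-- The defect commutes with all modes, so its value on `e^γ` is killed by all annihilation
operators and hence is a multiple of `e^γ`. It remains to see that its vacuum coefficient is zero.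
-/
theorem fockL_comm (lam mu : ℂ) (γ : Hyp) (m n : ℤ) :
    fockL lam mu γ m * fockL lam mu γ n - fockL lam mu γ n * fockL lam mu γ m =
      ((m : ℂ) - n) • fockL lam mu γ (m + n)
        + (if m = -n then ((m : ℂ) ^ 3 - m) / 12 else 0) •
          ((2 - 12 * (lam ^ 2 - mu ^ 2)) • (1 : Module.End ℂ (M1 γ))) := by
  -- By antisymmetry the larger index can be taken first. If it is positive, `L(m)` kills `e^γ` and
  -- only one of the two products contributes.
  wlog hmn : n ≤ m generalizing m n
  · have h := this n m (by omega)
    rw [← neg_sub, h, add_comm n m]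
    by_cases e : m = -n
    · obtain rfl : n = -m := by omega
      rw [if_pos rfl, if_pos (neg_neg m).symm]
      push_cast
      module
    · rw [if_neg e, if_neg (by omega)]
      module
  rw [smul_smul, ← sub_eq_zero, ← sub_sub]
  apply M1.end_eq_zero _ ?_ fun x k w => fockL_bracket_mode lam mu γ x m n k w _
  apply eq_zero_of_vacCoeff
  · intro x k hk
    rw [← fockL_bracket_mode, modeOp_expVec _ _ _ hk, map_zero]
  · simp only [LinearMap.sub_apply, LinearMap.smul_apply, Module.End.mul_apply,
      Module.End.one_apply, map_sub, map_smul, vacCoeff_expVec, vacCoeff_fockL_expVec, smul_eq_mul,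
      mul_one]
    rcases lt_trichotomy m 0 with hm | rfl | hm
    · rw [vacCoeff_fockL_neg _ _ _ hm, vacCoeff_fockL_neg _ _ _ (by omega), if_neg (by omega),
        if_neg (by omega)]
      simp
    · rcases hmn.lt_or_eq with hn | rfl
      · rw [vacCoeff_fockL_zero, vacCoeff_fockL_neg _ _ _ hn, vacCoeff_fockL_neg _ _ _ hn,
          if_neg (by omega), if_neg (by omega)]
        simp
      · simp
    · rw [fockL_expVec_pos _ _ _ hm, map_zero, map_zero]
      rcases lt_trichotomy n 0 with hn | rfl | hn
      · obtain ⟨p, rfl⟩ : ∃ p : ℕ, n = -((p : ℤ) + 1) := ⟨(-n - 1).toNat, by omega⟩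
        rw [vacCoeff_fockL_fockL _ _ _ hm]
        by_cases h : m = (p : ℤ) + 1
        · subst h
          simp
          ring
        · rw [if_neg h, if_neg (by omega), if_neg (by omega)]
          simp
      · rw [fockL_expVec_zero, map_smul, fockL_expVec_pos _ _ _ hm, if_neg (by omega),
          if_neg (by omega)]
        simp
      · rw [fockL_expVec_pos _ _ _ hn, map_zero, map_zero, if_neg (by omega), if_neg (by omega)]
        simp

theorem fockGen_bracket (lam mu : ℂ) (γ : Hyp) (x y : HVirGen) :
    Finsupp.linearCombination ℂ (fockGen lam mu γ) (hvirBr x y) =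
      fockGen lam mu γ x * fockGen lam mu γ y - fockGen lam mu γ y * fockGen lam mu γ x := by
  have hLI : ∀ n m, fockL lam mu γ n * fockI γ m - fockI γ m * fockL lam mu γ n =
      (-(m : ℂ)) • fockI γ (n + m)
        - (if n = -m then (n : ℂ) ^ 2 + n else 0) • (lam - mu) • (1 : Module.End ℂ (M1 γ)) := by
    intro n m
    refine LinearMap.ext fun w => ?_
    -- This pairing is the value of `C_{LI}`.
    have e : bgCharge lam mu (alpha + beta) = lam - mu := by
      simp [bgCharge, form, alpha, beta, hypBasis, sub_eq_add_neg]
    simp only [LinearMap.sub_apply, Module.End.mul_apply, fockI, fockL_mode, e,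
      LinearMap.smul_apply, Module.End.one_apply]
    split_ifs <;> module
  cases x <;> cases y <;>
    simp only [hvirBr, map_add, map_sub, map_smul, Finsupp.linearCombination_single, fockGen,
      map_zero, one_smul, mul_zero, zero_mul, smul_mul_assoc, mul_smul_comm, mul_one, one_mul,
      sub_self]
  · rw [fockL_comm]
  · rw [hLI]
  · rw [← neg_sub (fockL lam mu γ _ * fockI γ _), hLI]
    module
  · refine LinearMap.ext fun w => ?_
    simp only [LinearMap.sub_apply, Module.End.mul_apply, fockI]
    rw [modeOp_comm]
    simp [form, alpha, beta, hypBasis]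
  all_goals module

theorem fockAction_lie (lam mu : ℂ) (γ : Hyp) (x y : HVir) : fockAction lam mu γ ⁅x, y⁆ =
    fockAction lam mu γ x * fockAction lam mu γ y
      - fockAction lam mu γ y * fockAction lam mu γ x :=
  linearCombination_bilinExt hvirBr (fockGen lam mu γ) (fockGen_bracket lam mu γ) x y

theorem fockAction_of (lam mu : ℂ) (γ : Hyp) (x : HVirGen) :
    fockAction lam mu γ (HVir.of x) = fockGen lam mu γ x :=
  (Finsupp.linearCombination_single ℂ _ _).trans (one_smul _ _)


/-! ### Words of creation operators -/

/-- The negative generators: `I(-k-1)` for `(false, k)` and `L(-k-1)` for `(true, k)`. -/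
def negGen : Bool × ℕ → HVirGen
  | (false, k) => .I (-((k : ℤ) + 1))
  | (true, k) => .L (-((k : ℤ) + 1))

/-- The filtration degree: `0` for `I(-n)`, and `n + 1` for `J(-n)` and `L(-n)`. -/
def genDeg : Bool × ℕ → ℕ
  | (false, _) => 0
  | (true, k) => k + 2

/-- The filtration degree of a word. -/
def wordDeg (l : List (Bool × ℕ)) : ℕ := (l.map genDeg).sum

theorem wordDeg_cons (i : Bool × ℕ) (l : List (Bool × ℕ)) :
    wordDeg (i :: l) = genDeg i + wordDeg l := by
  simp [wordDeg]

theorem wordDeg_perm {l l' : List (Bool × ℕ)} (h : l.Perm l') : wordDeg l = wordDeg l' :=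
  (h.map genDeg).sum_eq

theorem HVir.lie_of (x y : HVirGen) : ⁅HVir.of x, HVir.of y⁆ = (hvirBr x y : HVir) :=
  bilinExt_single hvirBr x y

theorem HVir.lie_L_L (n m : ℤ) (h : n ≠ -m) :
    ⁅HVir.of (.L n), HVir.of (.L m)⁆ = ((n : ℂ) - m) • HVir.of (.L (n + m)) := by
  rw [HVir.lie_of, hvirBr, if_neg h, zero_smul, add_zero]
  rfl

theorem HVir.lie_L_I (n m : ℤ) (h : n ≠ -m) :
    ⁅HVir.of (.L n), HVir.of (.I m)⁆ = (-(m : ℂ)) • HVir.of (.I (n + m)) := by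
  rw [HVir.lie_of, hvirBr, if_neg h, zero_smul, sub_zero]
  rfl

theorem HVir.lie_I_I (n m : ℤ) (h : n ≠ -m) : ⁅HVir.of (.I n), HVir.of (.I m)⁆ = 0 := by
  rw [HVir.lie_of, hvirBr, if_neg h, zero_smul]
  rfl

theorem HVir.induction {p : HVir → Prop} (zero : p 0)
    (add : ∀ u v, p u → p v → p (u + v)) (smul : ∀ (t : ℂ) u, p u → p (t • u))
    (of : ∀ x, p (HVir.of x)) (u : HVir) : p u := by
  induction u using Finsupp.induction_linear with
  | zero => exact zero
  | add u v hu hv => exact add u v hu hv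
  | single x t =>
    have e : t • HVir.of x = (Finsupp.single x t : HVirGen →₀ ℂ) := Finsupp.smul_single_one _ _
    have h := smul t _ (of x)
    rwa [e] at h

/-! ### Words in the Verma module: spanning and reordering -/

section VermaWords

variable (cL cI cLI h hI : ℂ)

/-- The vector obtained by applying a word of negative generators to the highest weight vector. -/
def vermaWord (l : List (Bool × ℕ)) : Verma cL cI cLI h hI :=
  l.foldr (fun i w => ⁅HVir.of (negGen i), w⁆) (Ind.gen _)

/-- The span of the words of degree less than `d`. -/
def vermaFilt (d : ℕ) : Submodule ℂ (Verma cL cI cLI h hI) :=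
  Submodule.span ℂ (vermaWord cL cI cLI h hI '' {l | wordDeg l < d})

variable {cL cI cLI h hI}

theorem vermaWord_cons (i : Bool × ℕ) (l : List (Bool × ℕ)) :
    vermaWord cL cI cLI h hI (i :: l) =
      ⁅HVir.of (negGen i), vermaWord cL cI cLI h hI l⁆ := rfl

theorem vermaWord_mem_filt {l : List (Bool × ℕ)} {d : ℕ} (hl : wordDeg l < d) :
    vermaWord cL cI cLI h hI l ∈ vermaFilt cL cI cLI h hI d :=
  Submodule.subset_span ⟨l, hl, rfl⟩

theorem lie_mem_vermaFilt (i : Bool × ℕ) {d : ℕ} {w : Verma cL cI cLI h hI}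
    (hw : w ∈ vermaFilt cL cI cLI h hI d) :
    ⁅HVir.of (negGen i), w⁆ ∈ vermaFilt cL cI cLI h hI (genDeg i + d) := by
  induction hw using Submodule.span_induction with
  | mem w hw =>
    obtain ⟨l, hl, rfl⟩ := hw
    rw [← vermaWord_cons]
    apply vermaWord_mem_filt
    rw [wordDeg_cons]
    exact Nat.add_lt_add_left hl _
  | zero => rw [lie_zero]; exact Submodule.zero_mem _
  | add v w _ _ hv hw => rw [lie_add]; exact Submodule.add_mem _ hv hw
  | smul t w _ hw => rw [lie_smul]; exact Submodule.smul_mem _ _ hw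

/-- Two negative modes never meet a central term. `[L(-a-1), L(-b-1)]` is a multiple of `L(-a-b-2)`,
of degree `a + b + 3`, one less than the sum of the two degrees; `[L, I]` gives an `I` of degree
`0`, and the `I` commute. -/
theorem lie_lie_mem_vermaFilt (i j : Bool × ℕ) (l : List (Bool × ℕ)) :
    ⁅⁅HVir.of (negGen i), HVir.of (negGen j)⁆, vermaWord cL cI cLI h hI l⁆ ∈
      vermaFilt cL cI cLI h hI (genDeg i + (genDeg j + wordDeg l)) := by
  have hneg : ∀ a b : ℕ, -((a : ℤ) + 1) + -((b : ℤ) + 1) = -(((a + b + 1 : ℕ) : ℤ) + 1) := by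
    intro a b
    push_cast
    ring
  rcases i with ⟨_ | _, a⟩ <;> rcases j with ⟨_ | _, b⟩ <;> simp only [negGen, genDeg]
  · rw [HVir.lie_I_I _ _ (by omega), zero_lie]
    exact Submodule.zero_mem _
  · rw [← lie_skew, HVir.lie_L_I _ _ (by omega), neg_lie, smul_lie, hneg]
    refine Submodule.neg_mem _ (Submodule.smul_mem _ _ ?_)
    refine vermaWord_mem_filt (l := (false, _) :: l) ?_
    rw [wordDeg_cons, genDeg]
    omega
  · rw [HVir.lie_L_I _ _ (by omega), smul_lie, hneg]
    refine Submodule.smul_mem _ _ ?_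
    refine vermaWord_mem_filt (l := (false, _) :: l) ?_
    rw [wordDeg_cons, genDeg]
    omega
  · rw [HVir.lie_L_L _ _ (by omega), smul_lie, hneg]
    refine Submodule.smul_mem _ _ ?_
    refine vermaWord_mem_filt (l := (true, _) :: l) ?_
    rw [wordDeg_cons, genDeg]
    omega

/-- Up to words of lower degree, the order of the letters of a word does not matter. -/
theorem vermaWord_perm {l l' : List (Bool × ℕ)} (hp : l.Perm l') :
    vermaWord cL cI cLI h hI l - vermaWord cL cI cLI h hI l' ∈
      vermaFilt cL cI cLI h hI (wordDeg l) := by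
  induction hp with
  | nil => rw [sub_self]; exact Submodule.zero_mem _
  | cons i _ ih =>
    rw [vermaWord_cons, vermaWord_cons, ← lie_sub, wordDeg_cons]
    exact lie_mem_vermaFilt i ih
  | swap i j l =>
    have e : vermaWord cL cI cLI h hI (j :: i :: l) - vermaWord cL cI cLI h hI (i :: j :: l) =
        ⁅⁅HVir.of (negGen j), HVir.of (negGen i)⁆, vermaWord cL cI cLI h hI l⁆ := by
      simp only [vermaWord_cons]
      rw [leibniz_lie, add_sub_cancel_right]
    rw [e, wordDeg_cons, wordDeg_cons]
    exact lie_lie_mem_vermaFilt j i l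
  | trans h₁ _ ih₁ ih₂ =>
    rw [← wordDeg_perm h₁] at ih₂
    have := Submodule.add_mem _ ih₁ ih₂
    rwa [sub_add_sub_cancel] at this

theorem lie_gen_mem_span (x : HVirGen) : ⁅HVir.of x, vermaWord cL cI cLI h hI []⁆ ∈
    Submodule.span ℂ (Set.range (vermaWord cL cI cLI h hI)) := by
  have hrel : ∀ p ∈ vermaRel cL cI cLI h hI, ⁅p.1, vermaWord cL cI cLI h hI []⁆ ∈
      Submodule.span ℂ (Set.range (vermaWord cL cI cLI h hI)) := fun p hp => by
    refine (Ind.lie_gen _ hp).symm ▸ Submodule.smul_mem _ _ ?_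
    exact Submodule.subset_span ⟨[], rfl⟩
  cases x with
  | L n =>
    rcases int_trichotomy n with rfl | ⟨k, rfl⟩ | ⟨k, rfl⟩
    · exact hrel (_, h) (Or.inr (Or.inl rfl))
    · exact hrel (_, 0) (Or.inl ⟨_, by omega, Or.inl rfl⟩)
    · exact Submodule.subset_span ⟨[(true, k)], rfl⟩
  | I n =>
    rcases int_trichotomy n with rfl | ⟨k, rfl⟩ | ⟨k, rfl⟩
    · exact hrel (_, hI) (Or.inr (Or.inr (Or.inl rfl)))
    · exact hrel (_, 0) (Or.inl ⟨_, by omega, Or.inr rfl⟩)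
    · exact Submodule.subset_span ⟨[(false, k)], rfl⟩
  | CL => exact hrel (_, cL) (Or.inr (Or.inr (Or.inr (Or.inl rfl))))
  | CI => exact hrel (_, cI) (Or.inr (Or.inr (Or.inr (Or.inr (Or.inl rfl)))))
  | CLI => exact hrel (_, cLI) (Or.inr (Or.inr (Or.inr (Or.inr (Or.inr rfl)))))

/-- Moving `x` past the first letter `y` gives `x y w = [x, y] w + y (x w)`. The commutator is an
arbitrary element, so the induction is on words with `x` general. -/
theorem lie_vermaWord_mem_span (l : List (Bool × ℕ)) (x : HVir) :
    ⁅x, vermaWord cL cI cLI h hI l⁆ ∈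
      Submodule.span ℂ (Set.range (vermaWord cL cI cLI h hI)) := by
  induction l generalizing x with
  | nil =>
    induction x using HVir.induction with
    | zero => rw [zero_lie]; exact Submodule.zero_mem _
    | add u v hu hv => rw [add_lie]; exact Submodule.add_mem _ hu hv
    | smul t u hu => rw [smul_lie]; exact Submodule.smul_mem _ _ hu
    | of x => exact lie_gen_mem_span x
  | cons i l ih =>
    rw [vermaWord_cons, leibniz_lie]
    refine Submodule.add_mem _ (ih _) ?_
    have hx := ih x
    generalize ⁅x, vermaWord cL cI cLI h hI l⁆ = w at hx
    induction hx using Submodule.span_induction with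
    | mem w hw =>
      obtain ⟨l', rfl⟩ := hw
      exact Submodule.subset_span ⟨i :: l', rfl⟩
    | zero => rw [lie_zero]; exact Submodule.zero_mem _
    | add v w _ _ hv hw => rw [lie_add]; exact Submodule.add_mem _ hv hw
    | smul t w _ hw => rw [lie_smul]; exact Submodule.smul_mem _ _ hw

theorem span_vermaWord : Submodule.span ℂ (Set.range (vermaWord cL cI cLI h hI)) = ⊤ := by
  apply Ind.submodule_eq_top
  · exact Submodule.subset_span ⟨[], rfl⟩
  · intro x w hw
    induction hw using Submodule.span_induction with
    | mem w hw =>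
      obtain ⟨l, rfl⟩ := hw
      exact lie_vermaWord_mem_span l x
    | zero => rw [lie_zero]; exact Submodule.zero_mem _
    | add v w _ _ hv hw => rw [lie_add]; exact Submodule.add_mem _ hv hw
    | smul t w _ hw => rw [lie_smul]; exact Submodule.smul_mem _ _ hw

end VermaWords

/-! ### Words in a Fock module and their degree filtration -/

section FockWords

variable (γ : Hyp)

/-- The vector obtained by applying a word of creation operators to the highest weight vector. -/
def fockWord (l : List (Bool × ℕ)) : M1 γ := l.foldr (fun i w => creation γ i w) (expVec γ)

/-- The span of the words of degree less than `d`. -/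
def fockFilt (d : ℕ) : Submodule ℂ (M1 γ) :=
  Submodule.span ℂ (fockWord γ '' {l | wordDeg l < d})

variable {γ}

theorem fockWord_cons (i : Bool × ℕ) (l : List (Bool × ℕ)) :
    fockWord γ (i :: l) = creation γ i (fockWord γ l) := rfl

theorem toPoly_fockWord (l : List (Bool × ℕ)) :
    toPoly γ (fockWord γ l) = (l.map MvPolynomial.X).prod := by
  induction l with
  | nil => exact toPoly_expVec γ
  | cons i l ih => rw [fockWord_cons, toPoly_creation, ih, List.map_cons, List.prod_cons]

theorem fockWord_perm {l l' : List (Bool × ℕ)} (h : l.Perm l') : fockWord γ l = fockWord γ l' := by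
  apply (toPoly_bijective γ).1
  rw [toPoly_fockWord, toPoly_fockWord, (h.map _).prod_eq]

theorem fockFilt_mono {d e : ℕ} (h : d ≤ e) : fockFilt γ d ≤ fockFilt γ e :=
  Submodule.span_mono (Set.image_mono fun _ hl => lt_of_lt_of_le hl h)

theorem fockFilt_zero : fockFilt γ 0 = ⊥ := by
  simp [fockFilt]

theorem fockWord_mem_filt {l : List (Bool × ℕ)} {d : ℕ} (hl : wordDeg l < d) :
    fockWord γ l ∈ fockFilt γ d :=
  Submodule.subset_span ⟨l, hl, rfl⟩

theorem creation_mem_filt (i : Bool × ℕ) {d : ℕ} {w : M1 γ} (hw : w ∈ fockFilt γ d) :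
    creation γ i w ∈ fockFilt γ (genDeg i + d) := by
  induction hw using Submodule.span_induction with
  | mem w hw =>
    obtain ⟨l, hl, rfl⟩ := hw
    rw [← fockWord_cons]
    apply fockWord_mem_filt
    rw [wordDeg_cons]
    exact Nat.add_lt_add_left hl _
  | zero => rw [map_zero]; exact Submodule.zero_mem _
  | add v w _ _ hv hw => rw [map_add]; exact Submodule.add_mem _ hv hw
  | smul t w _ hw => rw [map_smul]; exact Submodule.smul_mem _ _ hw

theorem exists_mem_fockFilt (w : M1 γ) : ∃ d, w ∈ fockFilt γ d := by
  obtain ⟨p, hp⟩ : ∃ p, toPoly γ w = p := ⟨_, rfl⟩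
  induction p using MvPolynomial.induction_on generalizing w with
  | C t =>
    refine ⟨1, ?_⟩
    have e : w = t • expVec γ := by
      apply (toPoly_bijective γ).1
      rw [hp, map_smul, toPoly_expVec, MvPolynomial.C_eq_smul_one]
    rw [e]
    exact Submodule.smul_mem _ _ (fockWord_mem_filt (l := []) (by simp [wordDeg]))
  | add p q hp' hq' =>
    obtain ⟨u, hu⟩ := (toPoly_bijective γ).2 p
    obtain ⟨v, hv⟩ := (toPoly_bijective γ).2 q
    obtain ⟨d, hd⟩ := hp' u hu
    obtain ⟨e, he⟩ := hq' v hv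
    have h : w = u + v := by
      apply (toPoly_bijective γ).1
      rw [hp, map_add, hu, hv]
    rw [h]
    exact ⟨max d e, Submodule.add_mem _ (fockFilt_mono (le_max_left _ _) hd)
      (fockFilt_mono (le_max_right _ _) he)⟩
  | mul_X p i hp' =>
    obtain ⟨u, hu⟩ := (toPoly_bijective γ).2 p
    obtain ⟨d, hd⟩ := hp' u hu
    have h : w = creation γ i u := by
      apply (toPoly_bijective γ).1
      rw [hp, toPoly_creation, hu, mul_comm]
    rw [h]
    exact ⟨_, creation_mem_filt i hd⟩

end FockWords

/-- An operator that is unipotent with respect to an exhaustive filtration is bijective. -/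
theorem bijective_of_unipotent {P : Type} [AddCommGroup P] [Module ℂ P] (F : ℕ → Submodule ℂ P)
    (hbot : F 0 = ⊥) (htop : ∀ v, ∃ d, v ∈ F d) (U : Module.End ℂ P)
    (hU : ∀ d, ∀ v ∈ F (d + 1), U v - v ∈ F d) : Function.Bijective U := by
  constructor
  · rw [← LinearMap.ker_eq_bot, LinearMap.ker_eq_bot']
    intro v hv
    obtain ⟨d, hd⟩ := htop v
    induction d with
    | zero => rwa [hbot, Submodule.mem_bot] at hd
    | succ d ih =>
      have h := hU d v hd
      rw [hv, zero_sub, Submodule.neg_mem_iff] at h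
      exact ih h
  · intro v
    obtain ⟨d, hd⟩ := htop v
    induction d generalizing v with
    | zero =>
      rw [hbot, Submodule.mem_bot] at hd
      exact ⟨0, by rw [map_zero, hd]⟩
    | succ d ih =>
      obtain ⟨u, hu⟩ := ih _ (hU d v hd)
      exact ⟨v - u, by rw [map_sub, hu, sub_sub_cancel]⟩


/-! ### The map from the Verma module to the Fock module -/

/-- The coefficient of `J(-k-1)` in `L(-k-1)`. -/
def leadCoeff (lam mu : ℂ) (γ : Hyp) (k : ℕ) : ℂ := (form (alpha + beta) γ + k * (lam - mu)) / 2

/-- The lower order part of `L(-k-1)`. -/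
def lowerPart (lam mu : ℂ) (γ : Hyp) (k : ℕ) : Module.End ℂ (M1 γ) :=
  fockL lam mu γ (-((k : ℤ) + 1)) - leadCoeff lam mu γ k • creation γ (true, k)

/-- In the isotropic basis `I`, `J` the quadratic form has no square terms, so no product of two `J`
modes occurs in `L`. Such products would spoil the filtration. -/
theorem alpha_mode_sub_beta_mode (γ : Hyp) (m n : ℤ) (w : M1 γ) :
    modeOp γ alpha m (modeOp γ alpha n w) - modeOp γ beta m (modeOp γ beta n w) =
      (1 / 2 : ℂ) • (modeOp γ (lightVec false) m (modeOp γ (lightVec true) n w)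
        + modeOp γ (lightVec true) m (modeOp γ (lightVec false) n w)) := by
  simp only [lightVec, modeOp_add, modeOp_sub, LinearMap.add_apply, LinearMap.sub_apply, map_add,
    map_sub]
  module

theorem lowerPart_expVec (lam mu : ℂ) (γ : Hyp) (k : ℕ) :
    lowerPart lam mu γ k (expVec γ) =
      ((form alpha γ - form beta γ + k * (lam + mu)) / 2) • fockWord γ [(false, k)]
        + (1 / 4 : ℂ) • ∑ j ∈ Finset.range k,
          (fockWord γ [(false, j), (true, k - 1 - j)]
            + fockWord γ [(true, j), (false, k - 1 - j)]) := by
  have e : ∀ j ∈ Finset.range k, fockWord γ [(false, j), (true, k - 1 - j)]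
      + fockWord γ [(true, j), (false, k - 1 - j)] =
      (2 : ℂ) • (modeOp γ alpha (-((j : ℤ) + 1)) (modeOp γ alpha ((j : ℤ) - k) (expVec γ))
        - modeOp γ beta (-((j : ℤ) + 1)) (modeOp γ beta ((j : ℤ) - k) (expVec γ))) := by
    intro j hj
    rw [Finset.mem_range] at hj
    have e' : -(((k - 1 - j : ℕ) : ℤ) + 1) = j - k := by omega
    rw [alpha_mode_sub_beta_mode]
    simp only [fockWord, List.foldr, creation, e']
    module
  rw [Finset.sum_congr rfl e, ← Finset.smul_sum, Finset.sum_sub_distrib]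
  simp only [lowerPart, LinearMap.sub_apply, LinearMap.smul_apply, fockL_apply, quadOp_expVec_neg,
    fockWord, List.foldr, creation, lightVec, modeOp_add, modeOp_sub, LinearMap.add_apply,
    leadCoeff, form_add_left]
  push_cast
  module

/-- On `e^γ`, every `J` left after removing the leading term has a mode closer to zero than `-k-1`
and is accompanied by an `I` of degree `0`. Each further letter adds only its commutator with
`L(-k-1)`, which is strictly lower by the choice of degrees. -/
theorem lowerPart_fockWord (lam mu : ℂ) (γ : Hyp) (k : ℕ) (l : List (Bool × ℕ)) :
    lowerPart lam mu γ k (fockWord γ l) ∈ fockFilt γ (wordDeg l + (k + 2)) := by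
  induction l with
  | nil =>
    refine (lowerPart_expVec lam mu γ k).symm ▸ Submodule.add_mem _ (Submodule.smul_mem _ _ ?_)
      (Submodule.smul_mem _ _ (Submodule.sum_mem _ fun j hj => Submodule.add_mem _ ?_ ?_))
    all_goals
      apply fockWord_mem_filt
      simp only [wordDeg, genDeg, List.map, List.sum_cons, List.sum_nil]
    · omega
    · rw [Finset.mem_range] at hj
      omega
    · rw [Finset.mem_range] at hj
      omega
  | cons i l ih =>
    -- The subtracted term with `J(-k-1)` commutes with creation operators, so the whole correction
    -- is `[L(-k-1), x(-i-1)] = (i+1) x(-i-k-2)`, whose variable has index `i + k + 1`.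
    have e : lowerPart lam mu γ k (fockWord γ (i :: l)) =
        creation γ i (lowerPart lam mu γ k (fockWord γ l))
          + ((i.2 : ℂ) + 1) • fockWord γ ((i.1, i.2 + k + 1) :: l) := by
      have e₁ : -((k : ℤ) + 1) + -((i.2 : ℤ) + 1) = -(((i.2 + k + 1 : ℕ) : ℤ) + 1) := by
        push_cast
        ring
      have e₂ : creation γ (true, k) (creation γ i (fockWord γ l)) =
          creation γ i (creation γ (true, k) (fockWord γ l)) :=
        LinearMap.congr_fun (creation_comm γ _ _) _
      simp only [lowerPart, LinearMap.sub_apply, LinearMap.smul_apply, fockWord_cons, map_sub,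
        map_smul, e₂]
      have e₃ : creation γ i = modeOp γ (lightVec i.1) (-((i.2 : ℤ) + 1)) := rfl
      have e₄ : creation γ (i.1, i.2 + k + 1) =
        modeOp γ (lightVec i.1) (-(((i.2 + k + 1 : ℕ) : ℤ) + 1)) := rfl
      rw [e₃, e₄, fockL_mode, if_neg (by omega), e₁]
      push_cast
      module
    rw [e]
    refine Submodule.add_mem _ ?_ (Submodule.smul_mem _ _ (fockWord_mem_filt ?_))
    · rw [wordDeg_cons, add_assoc]
      exact creation_mem_filt i ih
    · rw [wordDeg_cons, wordDeg_cons]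
      rcases i with ⟨_ | _, j⟩ <;> simp only [genDeg] <;> omega

theorem lowerPart_mem_filt (lam mu : ℂ) (γ : Hyp) (k : ℕ) {d : ℕ} {w : M1 γ}
    (hw : w ∈ fockFilt γ d) : lowerPart lam mu γ k w ∈ fockFilt γ (d + (k + 2)) := by
  induction hw using Submodule.span_induction with
  | mem w hw =>
    obtain ⟨l, hl, rfl⟩ := hw
    exact fockFilt_mono (Nat.add_le_add_right (le_of_lt hl) _) (lowerPart_fockWord lam mu γ k l)
  | zero => rw [map_zero]; exact Submodule.zero_mem _
  | add v w _ _ hv hw => rw [map_add]; exact Submodule.add_mem _ hv hw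
  | smul t w _ hw => rw [map_smul]; exact Submodule.smul_mem _ _ hw

theorem fockL_eq_lowerPart (lam mu : ℂ) (γ : Hyp) (k : ℕ) (w : M1 γ) :
    fockL lam mu γ (-((k : ℤ) + 1)) w =
      leadCoeff lam mu γ k • creation γ (true, k) w + lowerPart lam mu γ k w := by
  simp [lowerPart]

/-! ### Leading terms of the comparison map and its bijectivity -/

section Comparison

variable (lam mu : ℂ) (γ : Hyp)

/-- The Verma module with the parameters of a Fock module. -/
abbrev FockVerma : Type :=
  Verma (2 - 12 * (lam ^ 2 - mu ^ 2)) 0 (lam - mu) (weight lam mu γ) (form (alpha + beta) γ)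

theorem fockAction_rel : ∀ p ∈ vermaRel (2 - 12 * (lam ^ 2 - mu ^ 2)) 0 (lam - mu)
    (weight lam mu γ) (form (alpha + beta) γ),
    fockAction lam mu γ p.1 (expVec γ) = p.2 • expVec γ := by
  rintro _ (⟨n, hn, rfl | rfl⟩ | rfl | rfl | rfl | rfl | rfl) <;>
    simp only [fockAction_of, fockGen]
  · rw [fockL_expVec_pos _ _ _ (by omega), zero_smul]
  · rw [fockI, modeOp_expVec _ _ _ hn, zero_smul]
  · rw [fockL_expVec_zero]
  · rw [fockI, modeOp_zero]
    rfl
  · rfl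
  · simp
  · rfl

/-- The homomorphism from the Verma module to the Fock module. -/
def vermaToFock : FockVerma lam mu γ →ₗ[ℂ] M1 γ :=
  Ind.lift _ (fockAction lam mu γ) (fockAction_lie lam mu γ) (expVec γ) (fockAction_rel lam mu γ)

theorem vermaToFock_lie (x : HVir) (v : FockVerma lam mu γ) :
    vermaToFock lam mu γ ⁅x, v⁆ = fockAction lam mu γ x (vermaToFock lam mu γ v) :=
  Ind.lift_lie _ _ _ _ _ x v

/-- The leading coefficient of a word. -/
def wordCoeff (l : List (Bool × ℕ)) : ℂ :=
  (l.map fun i => if i.1 then leadCoeff lam mu γ i.2 else 1).prod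

/-- The word in the Verma module with the parameters of a Fock module. -/
abbrev fvWord (l : List (Bool × ℕ)) : FockVerma lam mu γ := vermaWord _ _ _ _ _ l

/-- Triangularity of the comparison map: `I(-k-1)` acts exactly as the creation operator, and each
`L(-k-1)` may be replaced by `leadCoeff` times `J(-k-1)` up to lower degree. -/
theorem vermaToFock_word (l : List (Bool × ℕ)) :
    vermaToFock lam mu γ (fvWord lam mu γ l) - wordCoeff lam mu γ l • fockWord γ l ∈
      fockFilt γ (wordDeg l) := by
  induction l with
  | nil =>
    have h : vermaToFock lam mu γ (fvWord lam mu γ []) = fockWord γ [] := Ind.lift_gen _ _ _ _ _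
    rw [h, wordCoeff, List.map_nil, List.prod_nil, one_smul, sub_self]
    exact Submodule.zero_mem _
  | cons i l ih =>
    have hc : wordCoeff lam mu γ (i :: l) =
        (if i.1 then leadCoeff lam mu γ i.2 else 1) * wordCoeff lam mu γ l := by
      simp [wordCoeff]
    rw [fvWord, vermaWord_cons, vermaToFock_lie, fockAction_of, hc, fockWord_cons, wordDeg_cons]
    set v := vermaToFock lam mu γ (fvWord lam mu γ l)
    obtain ⟨f, hf⟩ : ∃ f, v - wordCoeff lam mu γ l • fockWord γ l = f := ⟨_, rfl⟩
    rw [hf] at ih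
    have hv : v = wordCoeff lam mu γ l • fockWord γ l + f := by rw [← hf]; abel
    rw [hv]
    rcases i with ⟨_ | _, k⟩
    · have e : fockGen lam mu γ (negGen (false, k)) = creation γ (false, k) := rfl
      rw [e, map_add, map_smul]
      simp only [Bool.false_eq_true, if_false, one_mul, add_sub_cancel_left]
      exact creation_mem_filt _ ih
    · have e : fockGen lam mu γ (negGen (true, k)) = fockL lam mu γ (-((k : ℤ) + 1)) := rfl
      rw [e, fockL_eq_lowerPart]
      simp only [if_true, map_add, map_smul]
      -- Three errors arise: the lower part on the leading word, the lower part on the previous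
      -- error, and the leading operator on the previous error.
      have h₁ := lowerPart_fockWord lam mu γ k l
      have h₂ := lowerPart_mem_filt lam mu γ k ih
      have h₃ := creation_mem_filt (true, k) ih
      rw [genDeg] at h₃ ⊢
      rw [add_comm (wordDeg l)] at h₁ h₂
      have h := Submodule.add_mem _ (Submodule.add_mem _
        (Submodule.smul_mem _ (wordCoeff lam mu γ l) h₁) h₂)
        (Submodule.smul_mem _ (leadCoeff lam mu γ k) h₃)
      convert h using 1
      module

theorem wordCoeff_ne_zero (hlead : ∀ k, leadCoeff lam mu γ k ≠ 0) (l : List (Bool × ℕ)) :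
    wordCoeff lam mu γ l ≠ 0 := by
  refine List.prod_ne_zero fun h => ?_
  obtain ⟨i, -, hi⟩ := List.mem_map.mp h
  split_ifs at hi
  · exact hlead _ hi
  · exact one_ne_zero hi

/-- A word with a given exponent vector. -/
def wordOf (s : (Bool × ℕ) →₀ ℕ) : List (Bool × ℕ) := (Finsupp.toMultiset s).toList

theorem wordOf_perm (l : List (Bool × ℕ)) :
    (wordOf (Multiset.toFinsupp (l : Multiset (Bool × ℕ)))).Perm l := by
  rw [← Multiset.coe_eq_coe, wordOf, Multiset.coe_toList, Multiset.toFinsupp_toMultiset]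

theorem prod_map_X (l : List (Bool × ℕ)) : (l.map MvPolynomial.X).prod =
    (MvPolynomial.monomial (Multiset.toFinsupp (l : Multiset (Bool × ℕ))) 1 : Poly) := by
  induction l with
  | nil => simp
  | cons i l ih =>
    rw [List.map_cons, List.prod_cons, ih, ← Multiset.cons_coe, ← Multiset.singleton_add,
      map_add, Multiset.toFinsupp_singleton, MvPolynomial.X, MvPolynomial.monomial_mul, one_mul]

/-- The linear map that sends a monomial to a normalized word. -/
def polyToVerma : Poly →ₗ[ℂ] FockVerma lam mu γ :=
  (MvPolynomial.basisMonomials (Bool × ℕ) ℂ).constr ℂ fun s =>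
    (wordCoeff lam mu γ (wordOf s))⁻¹ • fvWord lam mu γ (wordOf s)

theorem polyToVerma_monomial (s : (Bool × ℕ) →₀ ℕ) :
    polyToVerma lam mu γ (MvPolynomial.monomial s 1) =
      (wordCoeff lam mu γ (wordOf s))⁻¹ • fvWord lam mu γ (wordOf s) := by
  rw [polyToVerma, ← Module.Basis.constr_basis (MvPolynomial.basisMonomials (Bool × ℕ) ℂ) ℂ
    (fun s => (wordCoeff lam mu γ (wordOf s))⁻¹ • fvWord lam mu γ (wordOf s)) s,
    MvPolynomial.coe_basisMonomials]

variable {lam mu γ}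

/-- Words span, and by induction on degree each word is in the range: it differs by lower words from
the chosen ordering of its letters, whose normalized multiple is the image of a monomial. -/
theorem polyToVerma_surjective (hlead : ∀ k, leadCoeff lam mu γ k ≠ 0) :
    Function.Surjective (polyToVerma lam mu γ) := by
  rw [← LinearMap.range_eq_top, eq_top_iff, ← span_vermaWord, Submodule.span_le]
  have key : ∀ (d : ℕ) (l : List (Bool × ℕ)), wordDeg l < d →
      fvWord lam mu γ l ∈ LinearMap.range (polyToVerma lam mu γ) := by
    intro d
    induction d with
    | zero => exact fun l hl => absurd hl (Nat.not_lt_zero _)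
    | succ d ih =>
      intro l hl
      have hp := wordOf_perm l
      have h₁ : fvWord lam mu γ (wordOf (Multiset.toFinsupp (l : Multiset (Bool × ℕ)))) ∈
          LinearMap.range (polyToVerma lam mu γ) := by
        have h := Submodule.smul_mem _ (wordCoeff lam mu γ (wordOf (Multiset.toFinsupp
          (l : Multiset (Bool × ℕ))))) (LinearMap.mem_range_self (polyToVerma lam mu γ)
            (MvPolynomial.monomial (Multiset.toFinsupp (l : Multiset (Bool × ℕ))) 1))
        rwa [polyToVerma_monomial, smul_smul, mul_inv_cancel₀ (wordCoeff_ne_zero _ _ _ hlead _),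
          one_smul] at h
      have h₂ : fvWord lam mu γ l
          - fvWord lam mu γ (wordOf (Multiset.toFinsupp (l : Multiset (Bool × ℕ)))) ∈
          LinearMap.range (polyToVerma lam mu γ) := by
        refine (Submodule.span_le.mpr ?_ : vermaFilt _ _ _ _ _ (wordDeg l) ≤ _)
          (vermaWord_perm hp.symm)
        rintro _ ⟨l', hl', rfl⟩
        exact ih l' (lt_of_lt_of_le hl' (Nat.lt_succ_iff.mp hl))
      have h := Submodule.add_mem _ h₁ h₂
      rwa [add_sub_cancel] at h
  rintro _ ⟨l, rfl⟩
  exact key _ l (Nat.lt_succ_self _)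

/-- After the identification with polynomials, the composite Fock → Verma → Fock sends each word to
itself plus lower terms, so it is unipotent and bijective. Its first factor is onto, which forces
the second to be bijective. -/
theorem vermaToFock_bijective (hlead : ∀ k, leadCoeff lam mu γ k ≠ 0) :
    Function.Bijective (vermaToFock lam mu γ) := by
  have hU : Function.Bijective
      (vermaToFock lam mu γ ∘ₗ polyToVerma lam mu γ ∘ₗ toPoly γ) := by
    refine bijective_of_unipotent (fockFilt γ) fockFilt_zero exists_mem_fockFilt _ ?_
    intro d v hv
    induction hv using Submodule.span_induction with
    | mem w hw =>
      obtain ⟨l, hl, rfl⟩ := hw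
      have hp := wordOf_perm l
      have hne := wordCoeff_ne_zero lam mu γ hlead
        (wordOf (Multiset.toFinsupp (l : Multiset (Bool × ℕ))))
      have h := Submodule.smul_mem _ (wordCoeff lam mu γ (wordOf (Multiset.toFinsupp
          (l : Multiset (Bool × ℕ)))))⁻¹ (vermaToFock_word lam mu γ
        (wordOf (Multiset.toFinsupp (l : Multiset (Bool × ℕ)))))
      rw [smul_sub, smul_smul, inv_mul_cancel₀ hne, one_smul, fockWord_perm hp, wordDeg_perm hp,
        ← map_smul, ← polyToVerma_monomial, ← prod_map_X, ← toPoly_fockWord] at h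
      exact fockFilt_mono (Nat.lt_succ_iff.mp hl) h
    | zero => rw [map_zero, sub_zero]; exact Submodule.zero_mem _
    | add v w _ _ hv hw =>
      rw [map_add, add_sub_add_comm]
      exact Submodule.add_mem _ hv hw
    | smul t w _ hw =>
      rw [map_smul, ← smul_sub]
      exact Submodule.smul_mem _ _ hw
  have hs : Function.Surjective (polyToVerma lam mu γ ∘ₗ toPoly γ) :=
    (polyToVerma_surjective hlead).comp (toPoly_bijective γ).2
  constructor
  · intro v w h
    obtain ⟨v, rfl⟩ := hs v
    obtain ⟨w, rfl⟩ := hs w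
    rw [hU.1 h]
  · intro w
    obtain ⟨v, hv⟩ := hU.2 w
    exact ⟨_, hv⟩

end Comparison


/-! ### Modules over vertex algebras -/

section VertexModules

variable {V : Type} [AddCommGroup V] [Module ℂ V] {A : VertexAlgebra V}
  {W W' : Type} [AddCommGroup W] [Module ℂ W] [AddCommGroup W'] [Module ℂ W']

/-- The modes of a product in terms of the modes of its factors. -/
theorem VertexModule.product_mode (M : VertexModule A W) (a b : V) (n k : ℤ) (w : W) :
    M.Y (A.Y a n b) k w = ∑ᶠ j : ℕ, ((-1 : ℤ) ^ j * Ring.choose n j) •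
      (M.Y a (n - j) (M.Y b (k + j) w) - n.negOnePow • M.Y b (n + k - j) (M.Y a j w)) := by
  have h := M.borcherds a b w 0 n k
  -- With `m = 0` in the Borcherds identity the binomials `choose 0 j` with `j > 0` vanish, so the
  -- left side is the single term sought.
  rw [finsum_eq_single _ 0 fun j hj => by
    rw [Ring.choose_zero_pos ℤ (Nat.pos_of_ne_zero hj), zero_smul]] at h
  simpa using h

/-- Transport of a module structure along a linear isomorphism. -/
def VertexModule.transport (M : VertexModule A W) (φ : W ≃ₗ[ℂ] W') : VertexModule A W' where
  Y :=
    { toFun := fun a n => φ.conj (M.Y a n)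
      map_add' := fun a b => by
        ext n w
        simp
      map_smul' := fun t a => by
        ext n w
        simp }
  truncation := fun a w => by
    obtain ⟨N, hN⟩ := M.truncation a (φ.symm w)
    exact ⟨N, fun n hn => (congrArg φ (hN n hn)).trans (map_zero φ)⟩
  vac_apply := fun n w => by
    refine (congrArg φ (M.vac_apply n (φ.symm w))).trans ?_
    split_ifs
    · exact φ.apply_symm_apply w
    · exact map_zero φ
  borcherds := fun a b w m n k => by
    have h := congrArg φ (M.borcherds a b (φ.symm w) m n k)
    -- An injective additive map commutes with `finsum` without any finiteness condition.
    have e : ∀ f : ℕ → W, φ (∑ᶠ j, f j) = ∑ᶠ j, φ (f j) :=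
      fun f => φ.toAddEquiv.toAddMonoidHom.map_finsum_of_injective φ.injective f
    rw [e, e] at h
    simpa [map_zsmul, Units.smul_def] using h

theorem VertexModule.transport_apply (M : VertexModule A W) (φ : W ≃ₗ[ℂ] W') (a : V) (n : ℤ)
    (w : W') : (M.transport φ).Y a n w = φ (M.Y a n (φ.symm w)) := rfl

theorem VertexModule.eq_of_Y_eq {M N : VertexModule A W} (h : M.Y = N.Y) : M = N := by
  cases M
  cases N
  cases h
  rfl

/-- A module over a vertex algebra is determined by the action of generators. -/
theorem VertexModule.eq_of_gen {X : Set V}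
    {N N' : VertexModule (A.restrict (A.gen X) (A.isSub_gen X)) W}
    (h : ∀ (x : V) (hx : x ∈ X),
      N.Y ⟨x, A.subset_gen X hx⟩ = N'.Y ⟨x, A.subset_gen X hx⟩) : N = N' := by
  -- The locus where the two actions agree, pushed into `V`, is a vertex subalgebra by
  -- `product_mode`. It contains the generators, hence all of `A.gen X`.
  have hsub : A.IsSub ((LinearMap.eqLocus N.Y N'.Y).map (A.gen X).subtype) := by
    constructor
    · refine ⟨(A.restrict (A.gen X) (A.isSub_gen X)).vac, ?_, rfl⟩
      change N.Y _ = N'.Y _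
      ext n w
      rw [N.vac_apply, N'.vac_apply]
    · rintro _ ⟨a, ha, rfl⟩ _ ⟨b, hb, rfl⟩ n
      refine ⟨(A.restrict (A.gen X) (A.isSub_gen X)).Y a n b, ?_, rfl⟩
      change N.Y a = N'.Y a at ha
      change N.Y b = N'.Y b at hb
      change N.Y _ = N'.Y _
      ext k w
      rw [N.product_mode, N'.product_mode, ha, hb]
  have hle : A.gen X ≤ (LinearMap.eqLocus N.Y N'.Y).map (A.gen X).subtype := by
    refine sInf_le ⟨hsub, fun x hx => ?_⟩
    exact ⟨⟨x, A.subset_gen X hx⟩, h x hx, rfl⟩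
  apply VertexModule.eq_of_Y_eq
  refine LinearMap.ext fun a => ?_
  obtain ⟨b, hb, hab⟩ := hle a.2
  rw [← Subtype.ext (a1 := b) (a2 := a) hab]
  exact hb

theorem choose_neg_one (j : ℕ) : (-1 : ℤ) ^ j * Ring.choose (-1 : ℤ) j = 1 := by
  rw [Ring.choose_neg', Ring.multichoose_one]
  simp [Int.negOnePow_def, Units.smul_def, ← mul_pow]

theorem choose_neg_two (j : ℕ) : (-1 : ℤ) ^ j * Ring.choose (-2 : ℤ) j = j + 1 := by
  rw [Ring.choose_neg', Ring.multichoose_two]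
  have h : (-1 : ℤ) ^ j * (-1) ^ j = 1 := by simp [← mul_pow]
  simp only [Int.negOnePow_def, Units.smul_def, zpow_natCast, Units.val_pow_eq_pow_val,
    Units.val_neg, Units.val_one, smul_eq_mul]
  linear_combination ((j : ℤ) + 1) * h

theorem VertexModule.normalProduct_mode (M : VertexModule A W) (a b : V) (k : ℤ) (w : W) :
    M.Y (A.Y a (-1) b) k w = ∑ᶠ j : ℕ,
      (M.Y a (-1 - j) (M.Y b (k + j) w) + M.Y b (-1 + k - j) (M.Y a j w)) := by
  rw [M.product_mode]
  refine finsum_congr fun j => ?_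
  rw [choose_neg_one, one_smul]
  simp

/-- The vacuum has only the mode `-1`, which acts as the identity, so at most one summand survives:
from the second product if `k > 0`, from the first if `k < 0`, and none if `k = 0`. Its binomial
weight `j + 1` is `|k|`. -/
theorem VertexModule.derivative_mode (M : VertexModule A W) (a : V) (k : ℤ) (w : W) :
    M.Y (A.Y a (-2) A.vac) k w = (-(k : ℂ)) • M.Y a (k - 1) w := by
  rw [M.product_mode]
  simp only [choose_neg_two, M.vac_apply]
  have hsign : (-2 : ℤ).negOnePow = 1 := Int.negOnePow_even _ ⟨-1, rfl⟩
  rw [hsign]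
  rcases int_trichotomy k with rfl | ⟨p, rfl⟩ | ⟨p, rfl⟩
  · rw [finsum_congr fun j => ?_, finsum_zero]
    · simp
    · rw [if_neg (by omega), if_neg (by omega)]
      simp
  · rw [finsum_eq_single _ p]
    · rw [if_neg (by omega), if_pos (by ring), add_sub_cancel_right, map_zero, zero_sub, one_smul,
        ← Int.cast_smul_eq_zsmul ℂ]
      push_cast
      module
    · intro j hj
      rw [if_neg (by omega), if_neg (by omega)]
      simp
  · rw [finsum_eq_single _ p]
    · have e : -2 - (p : ℤ) = -((p : ℤ) + 1) - 1 := by ring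
      rw [if_pos (by ring), if_neg (by omega), smul_zero, sub_zero, e,
        ← Int.cast_smul_eq_zsmul ℂ]
      push_cast
      module
    · intro j hj
      rw [if_neg (by omega), if_neg (by omega)]
      simp

end VertexModules

/-- Pairing `k = -1 - j` with `k = j` matches the shape of the Borcherds sum in
`normalProduct_mode`. -/
theorem finsum_int {W : Type} [AddCommGroup W] (f : ℤ → W) (hf : (Function.support f).Finite) :
    ∑ᶠ k : ℤ, f k = ∑ᶠ j : ℕ, (f (-1 - j) + f j) := by
  have hi₁ : Function.Injective fun j : ℕ => -1 - (j : ℤ) := fun a b h => by simpa using h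
  have hi₂ : Function.Injective fun j : ℕ => (j : ℤ) := Nat.cast_injective
  have hd : Disjoint (Set.range fun j : ℕ => -1 - (j : ℤ)) (Set.range fun j : ℕ => (j : ℤ)) := by
    rw [Set.disjoint_left]
    rintro _ ⟨a, rfl⟩ ⟨b, hb⟩
    dsimp only at hb
    omega
  have hu : (Set.range fun j : ℕ => -1 - (j : ℤ)) ∪ (Set.range fun j : ℕ => (j : ℤ)) =
      Set.univ := by
    refine Set.eq_univ_of_forall fun k => ?_
    rcases lt_or_ge k 0 with h | h
    · exact Or.inl ⟨(-1 - k).toNat, by dsimp only; omega⟩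
    · exact Or.inr ⟨k.toNat, by dsimp only; omega⟩
  rw [← finsum_mem_univ, ← hu, finsum_mem_union' hd (hf.subset Set.inter_subset_right)
    (hf.subset Set.inter_subset_right), finsum_mem_range hi₁, finsum_mem_range hi₂,
    finsum_add_distrib]
  · exact hf.preimage hi₁.injOn
  · exact hf.preimage hi₂.injOn

theorem quadOp_eq_finsum_nat (γ x : Hyp) (n : ℤ) (w : M1 γ) : quadOp γ x n w = ∑ᶠ j : ℕ,
    (modeOp γ x (-1 - j) (modeOp γ x (n + 1 + j) w) + modeOp γ x (n - j) (modeOp γ x j w)) := by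
  rw [quadOp_apply, finsum_int _ (normOrd_finite γ x n w)]
  refine finsum_congr fun j => ?_
  congr 1
  · have e : n - (-1 - (j : ℤ)) = n + 1 + j := by ring
    rw [e, normOrd]
    split_ifs
    -- The two indices add up to `n`, so the factors can fail to commute only for `n = 0`; there the
    -- normal order already agrees with the Borcherds order.
    · exact modeOp_comm_of_ne γ x x (by omega) w
    · rfl
  · rw [normOrd]
    split_ifs
    · rfl
    · exact modeOp_comm_of_ne γ x x (by omega) w

/-! ### Modes of `I` and `ω` on a Fock module -/

section FockModules

variable {A : VertexAlgebra (M1 0)} {γ : Hyp} {M : VertexModule A (M1 γ)}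

theorem Y_vecI (hM : IsHeisenbergModule M) (n : ℤ) : M.Y vecI n = fockI γ n := by
  rw [vecI, map_add, Pi.add_apply, hM, hM, fockI, modeOp_add]

theorem Y_quadratic (hA : IsHeisenberg A) (hM : IsHeisenbergModule M) (x : Hyp) (n : ℤ) :
    M.Y (modeOp 0 x (-1) (modeOp 0 x (-1) (expVec 0))) (n + 1) = quadOp γ x n := by
  refine LinearMap.ext fun w => ?_
  rw [← hA.2 x (-1), M.normalProduct_mode, quadOp_eq_finsum_nat, hA.2]
  simp only [hM x]
  refine finsum_congr fun j => ?_
  have e : -1 + (n + 1) - (j : ℤ) = n - j := by ring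
  rw [e]

theorem Y_derivative (hA : IsHeisenberg A) (hM : IsHeisenbergModule M) (x : Hyp) (n : ℤ) :
    M.Y (modeOp 0 x (-2) (expVec 0)) (n + 1) = (-((n : ℂ) + 1)) • modeOp γ x n := by
  refine LinearMap.ext fun w => ?_
  rw [← hA.2 x (-2), ← hA.1, M.derivative_mode, hA.1, hM, add_sub_cancel_right]
  push_cast
  rfl

theorem Y_vecOmega (hA : IsHeisenberg A) (hM : IsHeisenbergModule M) (lam mu : ℂ) (n : ℤ) :
    M.Y (vecOmega lam mu) (n + 1) = fockL lam mu γ n := by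
  rw [vecOmega, map_add, map_add, map_sub, map_smul, map_smul, map_smul, map_smul]
  simp only [Pi.add_apply, Pi.sub_apply, Pi.smul_apply, Y_quadratic hA hM, Y_derivative hA hM,
    fockL]
  module

end FockModules

theorem weight_eq_Delta (lam mu r s : ℂ) :
    Delta lam mu r s = weight lam mu (r • alpha + s • beta) := by
  simp [Delta, weight, form, alpha, beta, hypBasis]
  ring

theorem form_add_fock (r s : ℂ) : r - s = form (alpha + beta) (r • alpha + s • beta) := by
  simp [form, alpha, beta, hypBasis]

end HVirFree

end

/-! ### The isomorphism of Lie algebra modules and of vertex algebra modules -/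

open HVirFree in
theorem mainTheorem10 (lam mu cL cLI r s h hI : ℂ)
    (hcL : cL = 2 - 12 * (lam ^ 2 - mu ^ 2)) (hcLI : cLI = lam - mu) (hcLI0 : cLI ≠ 0)
    (hh : h = Delta lam mu r s) (hhI : hI = r - s)
    (hp : ¬ ∃ p : ℕ, 0 < p ∧ hI / cLI - 1 = -(p : ℂ)) :
    ∃ φ : Fock r s ≃ₗ[ℂ] Verma cL 0 cLI h hI,
      (∀ (x : HVir) (w : Fock r s),
        φ (fockAction lam mu (r • alpha + s • beta) x w) = ⁅x, φ w⁆) ∧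
      ∀ (A : VertexAlgebra (M1 0)) (M : VertexModule A (Fock r s)),
        IsHeisenberg A → IsHeisenbergModule M →
        ∃ N : VertexModule (hvirVA A lam mu) (Verma cL 0 cLI h hI),
          ExtendsLie N ∧ (∀ N' : VertexModule (hvirVA A lam mu) (Verma cL 0 cLI h hI),
            ExtendsLie N' → N' = N) ∧
          IsModuleIso (M.restrict (hvirSub A lam mu) (A.isSub_gen _)) N φ := by
  rw [weight_eq_Delta] at hh
  rw [form_add_fock] at hhI
  subst hcL hcLI hh hhI
  -- A vanishing coefficient means `h_I = -k c_{L,I}`, hence `h_I / c_{L,I} - 1 = -(k + 1)`, a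
  -- negative integer.
  have hlead : ∀ k, leadCoeff lam mu (r • alpha + s • beta) k ≠ 0 := by
    intro k hk
    refine hp ⟨k + 1, Nat.succ_pos k, ?_⟩
    rw [leadCoeff, div_eq_zero_iff] at hk
    have hk' := eq_neg_of_add_eq_zero_left (hk.resolve_right two_ne_zero)
    rw [hk', neg_div, mul_div_cancel_right₀ _ hcLI0]
    push_cast
    ring
  let ψ := LinearEquiv.ofBijective _ (vermaToFock_bijective hlead)
  let φ := ψ.symm
  have hφ : ∀ (x : HVir) (w : Fock r s),
      φ (fockAction lam mu (r • alpha + s • beta) x w) = ⁅x, φ w⁆ := by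
    intro x w
    rw [LinearEquiv.symm_apply_eq]
    refine Eq.trans ?_ (vermaToFock_lie lam mu _ x (φ w)).symm
    exact congrArg _ (ψ.apply_symm_apply w).symm
  refine ⟨φ, hφ, fun A M hA hM => ?_⟩
  -- The required structure is the restricted Fock module carried over by `φ`. It extends the Lie
  -- action because `φ` intertwines and the modes of `I` and `ω` on the Fock module are `fockI` and
  -- `fockL`.
  have hN : ExtendsLie ((M.restrict (hvirSub A lam mu) (A.isSub_gen _)).transport φ) := by
    intro n w
    constructor
    · refine (congrArg (fun T => φ (T (φ.symm w))) (Y_vecI hM n)).trans ?_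
      refine (congrArg (fun T => φ (T (φ.symm w)))
        (fockAction_of lam mu (r • alpha + s • beta) (.I n))).symm.trans ?_
      exact (hφ _ _).trans (congrArg _ (φ.apply_symm_apply w))
    · refine (congrArg (fun T => φ (T (φ.symm w))) (Y_vecOmega hA hM lam mu n)).trans ?_
      refine (congrArg (fun T => φ (T (φ.symm w)))
        (fockAction_of lam mu (r • alpha + s • beta) (.L n))).symm.trans ?_
      exact (hφ _ _).trans (congrArg _ (φ.apply_symm_apply w))
  refine ⟨_, hN, fun N' hN' => ?_, fun a n w => ?_⟩
  · refine VertexModule.eq_of_gen (X := {vecI, vecOmega lam mu}) ?_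
    rintro x (rfl | rfl)
    · ext n w
      exact (hN' n w).1.trans (hN n w).1.symm
    · ext n w
      -- The mode of `ω` with index `n` is `L(n - 1)`.
      have h := (hN' (n - 1) w).2.trans (hN (n - 1) w).2.symm
      rwa [sub_add_cancel] at h
  · rw [VertexModule.transport_apply, LinearEquiv.symm_apply_apply]
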